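/- Let $B,C>0$, $0\le\delta<1$ and $\varepsilon>0$ be fixed real numbers and write $[x]$ for the integer part of $x$. For $n\ge 1$ put $N=[n^\delta]+n$, and let $\mathscr M_{n,\delta}(B,C)$ be the set of all $N\times N$ matrices with entries in $\{0,1\}$ whose first $[n^\delta]$ row sums and first $[n^\delta]$ column sums equal $[BCn]$ and whose remaining $n$ row sums and $n$ column sums equal $[Cn]$. Let $X=(X_{ij})$ be uniformly distributed on $\mathscr M_{n,\delta}(B,C)$. For $\mathbb N$-valued random variables let $d_{TV}(X_1,X_2)=\sum_{k\ge 0}|\mathbb P(X_1=k)-\mathbb P(X_2=k)|$, and let $\mathrm{Ber}(q)$ denote a random variable with $\mathbb P(\mathrm{Ber}(q)=1)=q$ and $\mathbb P(\mathrm{Ber}(q)=0)=1-q$, where $0\le q\le 1$. The $O$-terms refer to $n\to\infty$ and their constants may depend on $\delta,B,C,\varepsilon$. If $0\le\delta<1$, $0<C<1$ and $0<B\le 1/C$, then $\mathscr M_{n,\delta}(B,C)$ is nonempty for all sufficiently large $n$; this includes all cases below. The law of $X_{ij}$ depends only on whether $i\le[n^\delta]$ and whether $j\le[n^\delta]$.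 Moreover: (i) (Bottom right) If $0\le\delta<1$, $0<C<1$ and $0<B\le\frac1C$, then $$d_{TV}\bigl(X_{n+1,n+1},\mathrm{Ber}(C)\bigr)=O\bigl(n^{\delta-1}+n^{-\frac12+\varepsilon}\bigr).$$ (ii) (Top left) If $\frac12<\delta<1$, $0<C<\frac34$ and $0<B<\dfrac{1}{\sqrt{\frac C3-\frac{C^2}3}+C}$, then $\frac{B^2(1-C)}{B^2-2B+1/C}\in[0,1]$ and $$d_{TV}\Bigl(X_{1,1},\mathrm{Ber}\Bigl(\tfrac{B^2(1-C)}{B^2-2B+1/C}\Bigr)\Bigr)=O\bigl(n^{\delta-1}+n^{\frac12-\delta+\varepsilon}\bigr).$$ (iii) (Side blocks) If $0<\delta<1$, $0<C<\frac34$ and $0<B<\dfrac{1}{\sqrt{\frac C3-\frac{C^2}3}+C}$, then $BC\in[0,1]$ and $$d_{TV}\bigl(X_{1,n+1},\mathrm{Ber}(BC)\bigr)=d_{TV}\bigl(X_{n+1,1},\mathrm{Ber}(BC)\bigr)=O\bigl(n^{\delta-1}+n^{-\frac\delta2+\varepsilon}\bigr).$$ -/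

import Mathlib

open MeasureTheory ProbabilityTheory Filter Asymptotics

/-- Binary contingency tables with row sums `r` and column sums `c`: the `m × n` matrices with
entries in `{0, 1}`, row sums `r i` and column sums `c j`. -/
def binaryTables {m n : ℕ} (r : Fin m → ℕ) (c : Fin n → ℕ) : Set (Fin m → Fin n → ℕ) :=
  {D | (∀ i j, D i j = 0 ∨ D i j = 1) ∧ (∀ i, ∑ k, D i k = r i) ∧ (∀ j, ∑ k, D k j = c j)}

/-- The size `[n^δ]` of the first block. -/
noncomputable def blockSize (n : ℕ) (δ : ℝ) : ℕ := ⌊(n : ℝ) ^ δ⌋₊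

/-- The block margin `([BCn], …, [BCn], [Cn], …, [Cn])`, with `[n^δ]` entries equal to `[BCn]`
followed by `n` entries equal to `[Cn]`. -/
noncomputable def blockMargin (n : ℕ) (δ B C : ℝ) : Fin (blockSize n δ + n) → ℕ :=
  fun i => if (i : ℕ) < blockSize n δ then ⌊B * C * n⌋₊ else ⌊C * n⌋₊

/-- The binary contingency tables whose rows and columns both have the block margin. -/
noncomputable def blockTables (n : ℕ) (δ B C : ℝ) :
    Set (Fin (blockSize n δ + n) → Fin (blockSize n δ + n) → ℕ) :=
  binaryTables (blockMargin n δ B C) (blockMargin n δ B C)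

/-- The entry in row `i` and column `j` of an `N × N` matrix, with rows and columns numbered
`1, …, N`. Indices outside this range get the value `0`. -/
def entry {N : ℕ} (D : Fin N → Fin N → ℕ) (i j : ℕ) : ℕ :=
  if h : (1 ≤ i ∧ i ≤ N) ∧ (1 ≤ j ∧ j ≤ N) then
    D ⟨i - 1, by omega⟩ ⟨j - 1, by omega⟩
  else 0

/-- The law of the entry `X_{ij}` (with `i`, `j` counted from `1`), where `X` is uniformly
distributed on the set of binary contingency tables with the block margins. -/
noncomputable def entryLaw (n : ℕ) (δ B C : ℝ) (i j : ℕ) : Measure ℕ :=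
  (uniformOn (blockTables n δ B C)).map (fun X => entry X i j)

/-- Total variation distance of two laws on `ℕ`, normalised as the full `ℓ¹` distance
`∑ₖ |μ{k} - ν{k}|`. -/
noncomputable def tvDist (μ ν : Measure ℕ) : ℝ :=
  ∑' k : ℕ, |μ.real {k} - ν.real {k}|

/-- The law `Ber(q)` on `ℕ`: mass `q` at `1` and mass `1 - q` at `0`. -/
noncomputable def ber (q : unitInterval) : Measure ℕ := bernoulliMeasure 1 0 q

/-! Write `k` for the size of the first block. Row and column permutations within a block preserve
the uniform law, so all entries of one block have the same mean. An entry is `0` or `1`, so its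
distance to a Bernoulli law is twice the difference of the means.

For an entry outside the top left block, take a line through it (row or column) whose `n` entries in
the second block include it: the line sum fixes their common mean up to `k / n`, because the other
`k` entries contribute at most `k`. This gives `n ^ (δ - 1)` in (i) and (iii).

The top left block is too small for this, and a maximum entropy comparison is used. Choose Bernoulli
parameters `a`, `b`, `c` for the corner, side and bottom blocks so that the expected margins are
exact and the log-odds have the form `x i + y j` (`exists_block_parameters`). A product Bernoulli
matrix then gives every table the same weight, so summing over all 0-1 matrices bounds the
exponential moment of the corner sum over tables (`sum_exp_cornerSum_le`). Conversely the tables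
carry total weight at least `exp (-O(n log n))` (`choose_prod_le_card_tableFinset`): fill the four
blocks separately with balanced margins, which are the most frequent for a given total, and count
margins crudely.

By Jensen, the mean corner sum is `a k²` up to `μ k² + O(n log n) / μ` for every `0 < μ ≤ 1`. The
choice `μ = √n / k` gives the relative error `n ^ (1/2 - δ + ε)`, small when `δ > 1/2`. Finally `a`
differs from its limit by `O(k / n)`, since the odds equation determines it stably
(`abs_sub_mul_le_of_odds_eq`). -/

/-! ### Counting 0-1 matrices with given margins; balanced margins are extremal. -/

section Counting

variable {I J : Type*} [Fintype I] [DecidableEq I] [Fintype J] [DecidableEq J]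

/-- The matrices with entries in `{0, 1}`. -/
def zeroOneMatrices (I J : Type*) [Fintype I] [DecidableEq I] [Fintype J] [DecidableEq J] :
    Finset (I → J → ℕ) :=
  Fintype.piFinset fun _ => Fintype.piFinset fun _ => {0, 1}

/-- The binary contingency tables with row sums `r` and column sums `c`, as a finite set. -/
def tableFinset (r : I → ℕ) (c : J → ℕ) : Finset (I → J → ℕ) :=
  (zeroOneMatrices I J).filter fun D => (∀ i, ∑ j, D i j = r i) ∧ ∀ j, ∑ i, D i j = c j

theorem mem_zeroOneMatrices {D : I → J → ℕ} :
    D ∈ zeroOneMatrices I J ↔ ∀ i j, D i j = 0 ∨ D i j = 1 := by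
  simp [zeroOneMatrices]

theorem mem_tableFinset {r : I → ℕ} {c : J → ℕ} {D : I → J → ℕ} :
    D ∈ tableFinset r c ↔
      (∀ i j, D i j = 0 ∨ D i j = 1) ∧ (∀ i, ∑ j, D i j = r i) ∧ ∀ j, ∑ i, D i j = c j := by
  simp [tableFinset, mem_zeroOneMatrices]

theorem sum_zeroOneMatrices_prod {R : Type*} [CommSemiring R] (f : I → J → ℕ → R) :
    ∑ D ∈ zeroOneMatrices I J, ∏ i, ∏ j, f i j (D i j) = ∏ i, ∏ j, (f i j 0 + f i j 1) := by
  have h : ∀ i, ∏ j, (f i j 0 + f i j 1) =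
      ∑ x ∈ Fintype.piFinset fun _ : J => ({0, 1} : Finset ℕ), ∏ j, f i j (x j) := by
    intro i
    rw [← Finset.prod_univ_sum]
    simp
  simp_rw [h, Finset.prod_univ_sum]
  rfl

/-- Coefficient of `X ^ s` in the generating function `(1 + X) ^ (|I| |J|)`. -/
theorem card_zeroOneMatrices_filter_sum (s : ℕ) :
    ((zeroOneMatrices I J).filter fun D => ∑ i, ∑ j, D i j = s).card =
      (Fintype.card I * Fintype.card J).choose s := by
  have h := sum_zeroOneMatrices_prod (I := I) (J := J)
    (fun _ _ a => (Polynomial.X : Polynomial ℕ) ^ a)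
  have h' := congrArg (fun p => Polynomial.coeff p s) h
  simp only [Finset.prod_pow_eq_pow_sum, pow_zero, pow_one, Finset.prod_const, Finset.card_univ,
    Finset.sum_const, smul_eq_mul, Polynomial.finsetSum_coeff, Polynomial.coeff_X_pow,
    Polynomial.coeff_one_add_X_pow] at h'
  rw [Finset.card_filter]
  simp only [Nat.cast_id] at h'
  rw [← h']
  exact Finset.sum_congr rfl fun D _ => by simp [eq_comm]

/-- The `0`-`1` vectors `x` of sum `p` for which `v - x` is a `0`-`1` vector. -/
def splittings (v : I → ℕ) (p : ℕ) : Finset (I → ℕ) :=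
  (Fintype.piFinset fun i => ({0, 1} : Finset ℕ).filter fun a => a ≤ v i ∧ v i ≤ a + 1).filter
    fun x => ∑ i, x i = p

theorem mem_splittings {v x : I → ℕ} {p : ℕ} :
    x ∈ splittings v p ↔
      (∀ i, (x i = 0 ∨ x i = 1) ∧ x i ≤ v i ∧ v i ≤ x i + 1) ∧ ∑ i, x i = p := by
  simp [splittings]

/-- Where `v i` is `2` or `0` the value of `x i` is forced; where it is `1` the choice is free,
contributing a factor `1 + X`. -/
theorem card_splittings (v : I → ℕ) (hv : ∀ i, v i ≤ 2) (p : ℕ) :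
    (splittings v p).card =
      (Polynomial.X ^ (Finset.univ.filter fun i => v i = 2).card *
        (1 + Polynomial.X : Polynomial ℕ) ^ (Finset.univ.filter fun i => v i = 1).card).coeff p := by
  have h := Finset.prod_univ_sum
    (fun i => ({0, 1} : Finset ℕ).filter fun a => a ≤ v i ∧ v i ≤ a + 1)
    (fun _ a => (Polynomial.X : Polynomial ℕ) ^ a)
  have h1 : ∀ i, ∑ a ∈ ({0, 1} : Finset ℕ).filter (fun a => a ≤ v i ∧ v i ≤ a + 1),
      (Polynomial.X : Polynomial ℕ) ^ a =
      (if v i = 2 then Polynomial.X else 1) * (if v i = 1 then 1 + Polynomial.X else 1) := by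
    intro i
    have h2 := hv i
    rw [Finset.sum_filter]
    interval_cases v i <;> simp
  simp_rw [h1, Finset.prod_mul_distrib, Finset.prod_ite, Finset.prod_const_one, mul_one,
    Finset.prod_const, Finset.prod_pow_eq_pow_sum] at h
  rw [h, Polynomial.finsetSum_coeff, splittings, Finset.card_filter]
  exact Finset.sum_congr rfl fun D _ => by simp [Polynomial.coeff_X_pow, eq_comm]

theorem choose_succ_le_choose {u m : ℕ} (h : u ≤ 2 * m + 1) : u.choose (m + 1) ≤ u.choose m := by
  have h1 := Nat.choose_succ_right_eq u m
  have h2 : u.choose m * (u - m) ≤ u.choose m * (m + 1) := Nat.mul_le_mul_left _ (by omega)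
  exact Nat.le_of_mul_le_mul_right (h1.le.trans h2) (Nat.succ_pos m)

/-- After removal of the forced ones, both counts are binomial coefficients of the same `u`, at `m +
1` and `m`; `q ≤ p` says that `m + 1` lies beyond the middle. -/
theorem card_splittings_succ_le (v : I → ℕ) {p q : ℕ} (hv : ∑ i, v i = p + 1 + q) (hq : q ≤ p) :
    (splittings v (p + 1)).card ≤ (splittings v p).card := by
  by_cases h2 : ∀ i, v i ≤ 2
  · rw [card_splittings v h2, card_splittings v h2, Polynomial.coeff_X_pow_mul',
      Polynomial.coeff_X_pow_mul']
    simp only [Polynomial.coeff_one_add_X_pow, Nat.cast_id]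
    set w := (Finset.univ.filter fun i => v i = 2).card with hw
    set u := (Finset.univ.filter fun i => v i = 1).card with hu
    have hsum : ∑ i, v i = u + 2 * w := by
      rw [hu, hw, Finset.card_filter, Finset.card_filter, Finset.mul_sum, ← Finset.sum_add_distrib]
      refine Finset.sum_congr rfl fun i _ => ?_
      have := h2 i
      interval_cases v i <;> simp
    split_ifs with h3 h4
    · obtain ⟨m, rfl⟩ := Nat.exists_eq_add_of_le h4
      rw [show w + m + 1 - w = m + 1 by omega, show w + m - w = m by omega]
      exact choose_succ_le_choose (by omega)
    · omega
    · omega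
    · exact le_rfl
  · push Not at h2
    obtain ⟨i, hi⟩ := h2
    have : splittings v (p + 1) = ∅ := by
      ext x
      simp only [mem_splittings, Finset.notMem_empty, iff_false]
      rintro ⟨h, -⟩
      have := h i
      omega
    simp [this]

theorem sum_eq_of_pair {f g : J → ℕ} {j j' : J} (hne : j ≠ j') (h : f j + f j' = g j + g j')
    (h' : ∀ l, l ≠ j → l ≠ j' → f l = g l) : ∑ l, f l = ∑ l, g l := by
  have key : ∀ f : J → ℕ, ∑ l, f l = f j + f j' + ∑ l ∈ (Finset.univ.erase j).erase j', f l := by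
    intro f
    rw [add_assoc, Finset.add_sum_erase _ _ (by simp [hne.symm]),
      Finset.add_sum_erase _ _ (Finset.mem_univ _)]
  rw [key f, key g, h]
  congr 1
  exact Finset.sum_congr rfl fun l hl => h' l (by simp at hl; tauto) (by simp at hl; tauto)

/-- Moving a unit from a larger column sum to a smaller one does not decrease the number of
tables. -/
theorem card_tableFinset_le_of_transfer (r : I → ℕ) {c c' : J → ℕ} {j j' : J} (hlt : c j' < c j)
    (hj : c' j + 1 = c j) (hj' : c' j' = c j' + 1) (h : ∀ l, l ≠ j → l ≠ j' → c' l = c l) :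
    (tableFinset r c).card ≤ (tableFinset r c').card := by
  have hne : j ≠ j' := by rintro rfl; exact lt_irrefl _ hlt
  -- `φ` merges the columns `j` and `j'` into their sum. The tables in one fibre correspond to the
  -- ways of splitting this sum again, so the two counts are compared fibre by fibre.
  let φ : (I → J → ℕ) → (I → J → ℕ) := fun D i l =>
    if l = j then D i j + D i j' else if l = j' then 0 else D i l
  have hφ : ∀ s : Finset (I → J → ℕ), s ⊆ zeroOneMatrices I J →
      s.card = ∑ E ∈ (zeroOneMatrices I J).image φ, (s.filter fun D => φ D = E).card :=
    fun s hs => Finset.card_eq_sum_card_fiberwise fun D hD => Finset.mem_image_of_mem _ (hs hD)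
  rw [hφ (tableFinset r c) (Finset.filter_subset _ _), hφ (tableFinset r c') (Finset.filter_subset _ _)]
  refine Finset.sum_le_sum fun E _ => ?_
  rcases Finset.eq_empty_or_nonempty ((tableFinset r c).filter fun D => φ D = E) with h0 | ⟨D₀, h0⟩
  · simp [h0]
  rw [Finset.mem_filter, mem_tableFinset] at h0
  obtain ⟨⟨hD1, hDr, hDc⟩, rfl⟩ := h0
  set v : I → ℕ := fun i => D₀ i j + D₀ i j' with hv
  have hvsum : ∑ i, v i = c' j + 1 + c j' := by
    rw [hv, Finset.sum_add_distrib, hDc, hDc, hj]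
  calc ((tableFinset r c).filter fun D => φ D = φ D₀).card
      ≤ (splittings v (c' j + 1)).card := by
        refine Finset.card_le_card_of_injOn (fun D i => D i j) ?_ ?_
        · intro D hD
          simp only [Finset.coe_filter, Set.mem_ofPred_eq, mem_tableFinset] at hD
          obtain ⟨⟨h1, h2, h3⟩, h4⟩ := hD
          refine mem_splittings.2 ⟨fun i => ?_, by rw [h3 j, hj]⟩
          have h5 := congrFun (congrFun h4 i) j
          simp only [φ, if_true] at h5
          have := h1 i j
          have := h1 i j'
          simp only [hv]
          omega
        · intro D hD D' hD' hDD
          simp only [Finset.coe_filter, Set.mem_ofPred_eq] at hD hD'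
          have h4 := hD.2.trans hD'.2.symm
          funext i l
          have h5 : D i j = D' i j := congrFun hDD i
          have h6 := congrFun (congrFun h4 i) l
          have h7 := congrFun (congrFun h4 i) j
          simp only [φ, if_true] at h6 h7
          by_cases hl : l = j
          · rw [hl, h5]
          · by_cases hl' : l = j'
            · rw [hl']; omega
            · simpa [hl, hl'] using h6
    _ ≤ (splittings v (c' j)).card := card_splittings_succ_le v hvsum (by omega)
    _ ≤ ((tableFinset r c').filter fun D => φ D = φ D₀).card := by
        refine Finset.card_le_card_of_injOn
          (fun x i l => if l = j then x i else if l = j' then v i - x i else D₀ i l) ?_ ?_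
        · intro x hx
          obtain ⟨h1, h2⟩ := mem_splittings.1 hx
          simp only [Finset.coe_filter, Set.mem_ofPred_eq, mem_tableFinset]
          refine ⟨⟨fun i l => ?_, fun i => ?_, fun l => ?_⟩, ?_⟩
          · have := h1 i
            have := hD1 i l
            split_ifs <;> omega
          · rw [← hDr i]
            refine sum_eq_of_pair hne ?_ ?_
            · have := h1 i
              simp only [if_true, hne.symm, if_false]
              simp only [hv] at this ⊢
              omega
            · intro l hl hl'
              simp [hl, hl']
          · by_cases hl : l = j
            · simp [hl, h2]
            · by_cases hl' : l = j'
              · subst hl'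
                simp only [hl, if_false, if_true]
                have h3 : ∑ i, (v i - x i) + ∑ i, x i = ∑ i, v i := by
                  rw [← Finset.sum_add_distrib]
                  exact Finset.sum_congr rfl fun i _ => Nat.sub_add_cancel (h1 i).2.1
                omega
              · simp [hl, hl', hDc, h l hl hl']
          · funext i l
            have := h1 i
            simp only [φ, if_true, hne.symm, if_false]
            simp only [hv] at this ⊢
            split_ifs
            · omega
            · rfl
            · rfl
        · intro x _ y _ hxy
          funext i
          simpa using congrFun (congrFun hxy i) j

/-- Induction on the total excess of `c` over `c'`: move a unit from a column with `c j > c' j` to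
one with `c j' < c' j'`. Balance of `c'` forces `c j' < c j`, so each transfer is of the permitted
kind. -/
theorem card_tableFinset_le_of_balanced (r : I → ℕ) {c c' : J → ℕ}
    (hc' : ∀ j j', c' j ≤ c' j' + 1) (h : ∑ j, c j = ∑ j, c' j) :
    (tableFinset r c).card ≤ (tableFinset r c').card := by
  induction hm : ∑ j, (c j - c' j) using Nat.strong_induction_on generalizing c with
  | _ m ih =>
  by_cases hle : ∀ j, c j ≤ c' j
  · have : c = c' := by
      funext j
      exact (Finset.sum_eq_sum_iff_of_le fun j _ => hle j).1 h j (Finset.mem_univ _)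
    rw [this]
  push Not at hle
  obtain ⟨j, hj⟩ := hle
  have : ∃ j', c j' < c' j' := by
    by_contra hcon
    push Not at hcon
    exact hj.ne ((Finset.sum_eq_sum_iff_of_le fun j _ => hcon j).1 h.symm j (Finset.mem_univ _))
  obtain ⟨j', hj'⟩ := this
  have h1 := hc' j' j
  have hne : j ≠ j' := by rintro rfl; omega
  set d : J → ℕ := fun l => if l = j then c j - 1 else if l = j' then c j' + 1 else c l with hd
  have dj : d j = c j - 1 := by simp [hd]
  have dj' : d j' = c j' + 1 := by simp [hd, hne.symm]
  have dl : ∀ l, l ≠ j → l ≠ j' → d l = c l := fun l h2 h3 => by simp [hd, h2, h3]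
  have hsum : ∑ l, d l = ∑ l, c l :=
    sum_eq_of_pair hne (by rw [dj, dj']; omega) dl
  refine (card_tableFinset_le_of_transfer r (c' := d) (j := j) (j' := j') (by omega)
    (by omega) dj' dl).trans (ih _ ?_ (hsum.trans h) rfl)
  rw [← hm]
  refine Finset.sum_lt_sum (fun l _ => ?_) ⟨j, Finset.mem_univ _, by rw [dj]; omega⟩
  by_cases h2 : l = j
  · subst h2; omega
  · by_cases h3 : l = j'
    · subst h3; omega
    · rw [dl l h2 h3]

theorem card_tableFinset_comm (r : I → ℕ) (c : J → ℕ) :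
    (tableFinset r c).card = (tableFinset c r).card :=
  Finset.card_bij' (fun D _ j i => D i j) (fun D _ i j => D j i)
    (fun D hD => by rw [mem_tableFinset] at hD ⊢; exact ⟨fun i j => hD.1 j i, hD.2.2, hD.2.1⟩)
    (fun D hD => by rw [mem_tableFinset] at hD ⊢; exact ⟨fun i j => hD.1 j i, hD.2.2, hD.2.1⟩) (fun _ _ => rfl) (fun _ _ => rfl)

/-- Tables with balanced margins are the most frequent among all `0`-`1` matrices of given sum. -/
theorem choose_le_card_tableFinset {r : I → ℕ} {c : J → ℕ} {s : ℕ}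
    (hr : ∀ i i', r i ≤ r i' + 1) (hc : ∀ j j', c j ≤ c j' + 1) (hrs : ∑ i, r i = s)
    (hcs : ∑ j, c j = s) :
    (Fintype.card I * Fintype.card J).choose s ≤
      (Fintype.card J + 1) ^ Fintype.card I * (Fintype.card I + 1) ^ Fintype.card J *
        (tableFinset r c).card := by
  rw [← card_zeroOneMatrices_filter_sum (I := I) (J := J)]
  -- `T` contains all possible margins; each class of matrices with fixed margins has at most as
  -- many members as the balanced class.
  let T := (Fintype.piFinset fun _ : I => Finset.range (Fintype.card J + 1)) ×ˢ
    (Fintype.piFinset fun _ : J => Finset.range (Fintype.card I + 1))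
  let f : (I → J → ℕ) → (I → ℕ) × (J → ℕ) := fun D => (fun i => ∑ j, D i j, fun j => ∑ i, D i j)
  have hbound : ∀ D ∈ zeroOneMatrices I J, ∀ i j, D i j ≤ 1 := fun D hD i j => by
    have := mem_zeroOneMatrices.1 hD i j
    omega
  have hT : T.card = (Fintype.card J + 1) ^ Fintype.card I * (Fintype.card I + 1) ^ Fintype.card J := by
    simp [T]
  rw [← hT, Finset.card_eq_sum_card_fiberwise (f := f) (t := T), ← smul_eq_mul]
  · refine Finset.sum_le_card_nsmul _ _ _ fun rc _ => ?_
    by_cases hs : ∑ i, rc.1 i = s ∧ ∑ j, rc.2 j = s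
    · calc _ ≤ (tableFinset rc.1 rc.2).card := by
            refine Finset.card_le_card fun D hD => ?_
            simp only [Finset.mem_filter, mem_zeroOneMatrices] at hD
            obtain ⟨⟨h1, -⟩, rfl⟩ := hD
            exact mem_tableFinset.2 ⟨h1, fun _ => rfl, fun _ => rfl⟩
        _ ≤ (tableFinset rc.1 c).card := card_tableFinset_le_of_balanced _ hc (hs.2.trans hcs.symm)
        _ = (tableFinset c rc.1).card := card_tableFinset_comm _ _
        _ ≤ (tableFinset c r).card := card_tableFinset_le_of_balanced _ hr (hs.1.trans hrs.symm)
        _ = (tableFinset r c).card := card_tableFinset_comm _ _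
    · refine (Finset.card_eq_zero.2 ?_).trans_le (Nat.zero_le _)
      rw [Finset.filter_eq_empty_iff]
      rintro D hD rfl
      rw [Finset.mem_filter] at hD
      exact hs ⟨hD.2, by rw [← hD.2]; exact Finset.sum_comm⟩
  · intro D hD
    simp only [Finset.coe_filter, Set.mem_ofPred_eq] at hD
    have hD := hbound D hD.1
    simp only [T, f, Finset.coe_product, Set.mem_prod, Finset.mem_coe, Fintype.mem_piFinset,
      Finset.mem_range, Nat.lt_succ_iff]
    exact ⟨fun i => (Finset.sum_le_sum fun j _ => hD i j).trans (by simp),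
      fun j => (Finset.sum_le_sum fun i _ => hD i j).trans (by simp)⟩

end Counting

/-! ### Binomial estimates, exponential tilting and the entropy parameters. -/

section Binomial

/-- The mode of the binomial law with success probability `s / M` is `s`: successive ratios of the
weights compare with `1` on either side of it. -/
theorem pow_mul_pow_mul_choose_le {s t M j : ℕ} (h : s + t = M) (hj : j ≤ M) :
    s ^ j * t ^ (M - j) * M.choose j ≤ s ^ s * t ^ t * M.choose s := by
  have ht : M - s = t := by omega
  rw [← ht]
  rcases le_total j s with hjs | hjs
  · refine Nat.decreasingInduction' (P := fun j =>
      s ^ j * (M - s) ^ (M - j) * M.choose j ≤ s ^ s * (M - s) ^ (M - s) * M.choose s)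
      (fun i hi _ ih => le_trans ?_ ih) hjs le_rfl
    have h1 := Nat.choose_succ_right_eq M i
    have h2 : (M - s) * M.choose i ≤ s * M.choose (i + 1) := by
      calc (M - s) * M.choose i ≤ (M - i) * M.choose i := Nat.mul_le_mul_right _ (by omega)
        _ = (i + 1) * M.choose (i + 1) := by rw [mul_comm, ← h1, mul_comm]
        _ ≤ s * M.choose (i + 1) := Nat.mul_le_mul_right _ (by omega)
    have h3 : M - i = M - (i + 1) + 1 := by omega
    calc s ^ i * (M - s) ^ (M - i) * M.choose i
        = s ^ i * (M - s) ^ (M - (i + 1)) * ((M - s) * M.choose i) := by rw [h3]; ring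
      _ ≤ s ^ i * (M - s) ^ (M - (i + 1)) * (s * M.choose (i + 1)) := Nat.mul_le_mul_left _ h2
      _ = _ := by ring
  · induction j, hjs using Nat.le_induction with
    | base => exact le_rfl
    | succ i hi ih =>
      refine le_trans ?_ (ih (by omega))
      have h1 := Nat.choose_succ_right_eq M i
      have h2 : s * M.choose (i + 1) ≤ (M - s) * M.choose i := by
        calc s * M.choose (i + 1) ≤ (i + 1) * M.choose (i + 1) := Nat.mul_le_mul_right _ (by omega)
          _ = (M - i) * M.choose i := by rw [mul_comm, h1, mul_comm]
          _ ≤ (M - s) * M.choose i := Nat.mul_le_mul_right _ (by omega)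
      have h3 : M - i = M - (i + 1) + 1 := by omega
      calc s ^ (i + 1) * (M - s) ^ (M - (i + 1)) * M.choose (i + 1)
          = s ^ i * (M - s) ^ (M - (i + 1)) * (s * M.choose (i + 1)) := by ring
        _ ≤ s ^ i * (M - s) ^ (M - (i + 1)) * ((M - s) * M.choose i) := Nat.mul_le_mul_left _ h2
        _ = _ := by rw [h3]; ring

theorem pow_self_le_choose_mul {s t M : ℕ} (h : s + t = M) :
    M ^ M ≤ (M + 1) * (s ^ s * t ^ t * M.choose s) := by
  conv_lhs => rw [← h, add_pow, h]
  refine (Finset.sum_le_card_nsmul _ _ (s ^ s * t ^ t * M.choose s) fun j hj => ?_).trans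
    (by simp)
  exact pow_mul_pow_mul_choose_le h (by simpa [Nat.lt_succ_iff] using hj)

theorem pow_self_le_mul_exp (s : ℕ) {x : ℝ} (hx : 0 < x) :
    (s : ℝ) ^ s ≤ x ^ s * Real.exp (s * (s / x - 1)) := by
  have h := Real.add_one_le_exp ((s : ℝ) / x - 1)
  rw [sub_add_cancel, div_le_iff₀ hx] at h
  calc (s : ℝ) ^ s ≤ (Real.exp ((s : ℝ) / x - 1) * x) ^ s := by gcongr
    _ = _ := by rw [mul_pow, ← Real.exp_nat_mul, mul_comm]

/-- A lower bound for the binomial distribution near its mean. -/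
theorem one_le_choose_mul_pow_mul_exp {s t M : ℕ} (h : s + t = M) {a : ℝ} (ha : 0 < a)
    (ha' : a < 1) :
    1 ≤ (M + 1) * (M.choose s * (a ^ s * (1 - a) ^ t)) *
      Real.exp ((s - a * M) ^ 2 / (M * (a * (1 - a)))) := by
  rcases Nat.eq_zero_or_pos M with rfl | hM
  · obtain ⟨rfl, rfl⟩ : s = 0 ∧ t = 0 := by omega
    simp
  have hM' : (0 : ℝ) < M := by exact_mod_cast hM
  have hb : 0 < 1 - a := by linarith
  have h1 := pow_self_le_mul_exp s (mul_pos hM' ha)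
  have h2 := pow_self_le_mul_exp t (mul_pos hM' hb)
  have h3 : (M : ℝ) ^ M ≤ (M + 1) * (s ^ s * t ^ t * M.choose s) := by
    exact_mod_cast pow_self_le_choose_mul h
  have hst : (s : ℝ) + t = M := by exact_mod_cast h
  -- Relative entropy has been bounded by the chi-square distance, computed here.
  have hexp : (s : ℝ) * (s / (M * a) - 1) + t * (t / (M * (1 - a)) - 1) =
      (s - a * M) ^ 2 / (M * (a * (1 - a))) := by
    have ht : (t : ℝ) = M - s := by linarith
    rw [ht]
    field_simp
    ring
  have hpow : (M : ℝ) ^ s * (M : ℝ) ^ t = (M : ℝ) ^ M := by rw [← pow_add, h]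
  have h4 : (M : ℝ) ^ M * 1 ≤ (M : ℝ) ^ M * ((M + 1) * (M.choose s * (a ^ s * (1 - a) ^ t)) *
      Real.exp ((s - a * M) ^ 2 / (M * (a * (1 - a))))) := by
    calc (M : ℝ) ^ M * 1 ≤ (M + 1) * (s ^ s * t ^ t * M.choose s) := by rw [mul_one]; exact h3
      _ ≤ (M + 1) * (((M * a) ^ s * Real.exp (s * (s / (M * a) - 1))) *
          ((M * (1 - a)) ^ t * Real.exp (t * (t / (M * (1 - a)) - 1))) * M.choose s) := by
        gcongr
      _ = _ := by
        rw [← hexp, Real.exp_add, mul_pow, mul_pow, ← hpow]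
        ring
  exact le_of_mul_le_mul_left h4 (by positivity)

theorem bernoulli_mgf_le {a l : ℝ} (ha : 0 ≤ a) (ha' : a ≤ 1) (hl : |l| ≤ 1) :
    1 - a + a * Real.exp l ≤ Real.exp (a * l + l ^ 2) := by
  have h1 := (abs_le.1 (Real.abs_exp_sub_one_sub_id_le hl)).2
  have h2 := Real.add_one_le_exp (a * l + l ^ 2)
  nlinarith [sq_nonneg l]

/-- Jensen's inequality, from the tangent line of `exp` at the mean. -/
theorem card_mul_exp_mean_le {ι : Type*} {s : Finset ι} (hs : s.Nonempty) (f : ι → ℝ) :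
    s.card * Real.exp ((∑ i ∈ s, f i) / s.card) ≤ ∑ i ∈ s, Real.exp (f i) := by
  set m := (∑ i ∈ s, f i) / s.card with hm
  have hc : (s.card : ℝ) ≠ 0 := by exact_mod_cast hs.card_pos.ne'
  have h : ∑ i ∈ s, Real.exp m * (f i - m + 1) ≤ ∑ i ∈ s, Real.exp (f i) := by
    refine Finset.sum_le_sum fun i _ => ?_
    calc Real.exp m * (f i - m + 1) ≤ Real.exp m * Real.exp (f i - m) := by
          gcongr
          exact Real.add_one_le_exp _
      _ = Real.exp (f i) := by rw [← Real.exp_add]; congr 1; ring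
  refine le_trans (le_of_eq ?_) h
  rw [← Finset.mul_sum, Finset.sum_add_distrib, Finset.sum_sub_distrib]
  have : ∑ i ∈ s, f i = s.card * m := by rw [hm]; field_simp
  rw [this]
  simp
  ring

/-- The tilt by `x i + y j` depends only on the margins, so it is constant on tables; the sum over
all 0-1 matrices factorises. -/
theorem sum_exp_tableFinset_le {I J : Type*} [Fintype I] [DecidableEq I] [Fintype J]
    [DecidableEq J] (r : I → ℕ) (c : J → ℕ) (x : I → ℝ) (y : J → ℝ) (l : I → J → ℝ) :
    (∑ D ∈ tableFinset r c, Real.exp (∑ i, ∑ j, l i j * D i j)) *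
        Real.exp (∑ i, x i * r i + ∑ j, y j * c j) ≤
      ∏ i, ∏ j, (1 + Real.exp (x i + y j + l i j)) := by
  have h := sum_zeroOneMatrices_prod (I := I) (J := J)
    (fun i j a => Real.exp ((x i + y j + l i j) * a))
  simp only [Nat.cast_zero, mul_zero, Real.exp_zero, Nat.cast_one, mul_one] at h
  rw [← h, Finset.sum_mul]
  refine le_trans (le_of_eq ?_) (Finset.sum_le_sum_of_subset_of_nonneg
    (show tableFinset r c ⊆ zeroOneMatrices I J from Finset.filter_subset _ _)
    fun D _ _ => by positivity)
  refine Finset.sum_congr rfl fun D hD => ?_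
  obtain ⟨-, hr, hc⟩ := mem_tableFinset.1 hD
  simp_rw [← Real.exp_sum]
  rw [← Real.exp_add]
  congr 1
  simp_rw [add_mul, Finset.sum_add_distrib]
  have h1 : ∑ i, x i * (r i : ℝ) = ∑ i, ∑ j, x i * (D i j : ℝ) := by
    refine Finset.sum_congr rfl fun i _ => ?_
    rw [← hr i, Nat.cast_sum, Finset.mul_sum]
  have h2 : ∑ j, y j * (c j : ℝ) = ∑ i, ∑ j, y j * (D i j : ℝ) := by
    rw [Finset.sum_comm]
    refine Finset.sum_congr rfl fun j _ => ?_
    rw [← hc j, Nat.cast_sum, Finset.mul_sum]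
  rw [h1, h2]
  ring

/-- Bernoulli parameters of a maximum entropy matrix with two by two blocks. -/
theorem exists_block_parameters {k n R S : ℝ} (hk : 0 ≤ k) (hn : 0 < n) (hkR : k < R) (hRn : R < n)
    (hkS : k < S) (hSn : S < n) :
    ∃ a b c : ℝ, 0 < a ∧ a < 1 ∧ 0 < b ∧ b < 1 ∧ 0 < c ∧ c < 1 ∧ a * k + b * n = R ∧
      b * k + c * n = S ∧ a * c * (1 - b) ^ 2 = (1 - a) * (1 - c) * b ^ 2 := by
  -- The margin equations express `b` and `c` through `a`; the odds equation is then solved by the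
  -- intermediate value theorem, as `F` changes sign on `[0, 1]`.
  let b : ℝ → ℝ := fun a => (R - a * k) / n
  let c : ℝ → ℝ := fun a => (S - b a * k) / n
  let F : ℝ → ℝ := fun a => a * c a * (1 - b a) ^ 2 - (1 - a) * (1 - c a) * (b a) ^ 2
  have hb : ∀ a ∈ Set.Icc (0 : ℝ) 1, 0 < b a ∧ b a < 1 := by
    rintro a ⟨h0, h1⟩
    constructor
    · have : a * k ≤ k := by nlinarith
      exact div_pos (by linarith) hn
    · rw [div_lt_one hn]
      nlinarith
  have hc : ∀ a ∈ Set.Icc (0 : ℝ) 1, 0 < c a ∧ c a < 1 := by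
    intro a ha
    obtain ⟨h0, h1⟩ := hb a ha
    constructor
    · have : b a * k ≤ k := by nlinarith
      exact div_pos (by linarith) hn
    · rw [div_lt_one hn]
      nlinarith
  have hF : Continuous F := by fun_prop
  have hF0 : F 0 < 0 := by
    have h1 := hb 0 (by simp)
    have h2 := hc 0 (by simp)
    have : 0 < (1 - c 0) * (b 0) ^ 2 := mul_pos (by linarith) (pow_pos h1.1 2)
    simp only [F]
    linarith
  have hF1 : 0 < F 1 := by
    have h1 := hb 1 (by simp)
    have h2 := hc 1 (by simp)
    have : 0 < c 1 * (1 - b 1) ^ 2 := mul_pos h2.1 (pow_pos (by linarith) 2)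
    simp only [F]
    linarith
  obtain ⟨a, ⟨ha0, ha1⟩, ha⟩ := intermediate_value_Ioo zero_le_one hF.continuousOn ⟨hF0, hF1⟩
  have h1 := hb a ⟨ha0.le, ha1.le⟩
  have h2 := hc a ⟨ha0.le, ha1.le⟩
  refine ⟨a, b a, c a, ha0, ha1, h1.1, h1.2, h2.1, h2.2, ?_, ?_, sub_eq_zero.1 ha⟩
  · simp only [b]; field_simp; ring
  · simp only [c]; field_simp; ring

/-- The odds equation determines `a` as a Lipschitz function of `b` and `c`. -/
theorem abs_sub_mul_le_of_odds_eq {a b c a' b' c' : ℝ} (ha : 0 ≤ a) (ha1 : a ≤ 1) (hb : 0 ≤ b)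
    (hb1 : b ≤ 1) (hc : 0 ≤ c) (hc1 : c ≤ 1) (hb' : 0 ≤ b') (hb1' : b' ≤ 1) (hc' : 0 ≤ c')
    (hc1' : c' ≤ 1) (h : a * c * (1 - b) ^ 2 = (1 - a) * (1 - c) * b ^ 2)
    (h' : a' * c' * (1 - b') ^ 2 = (1 - a') * (1 - c') * b' ^ 2) :
    |a - a'| * (c' * (1 - b') ^ 2 + (1 - c') * b' ^ 2) ≤ 2 * |b - b'| + |c - c'| := by
  have hQ : 0 ≤ c' * (1 - b') ^ 2 + (1 - c') * b' ^ 2 :=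
    add_nonneg (mul_nonneg hc' (sq_nonneg _)) (mul_nonneg (by linarith) (sq_nonneg _))
  -- For fixed `b'`, `c'` the odds equation is affine in `a`, with slope the second factor on the
  -- left.
  have key : (a - a') * (c' * (1 - b') ^ 2 + (1 - c') * b' ^ 2) =
      (b - b') * (a * c * (2 - b - b') + (1 - a) * (1 - c) * (b + b')) -
        (c - c') * (a * (1 - b') ^ 2 + (1 - a) * b' ^ 2) := by
    linear_combination h - h'
  have hP : |a * c * (2 - b - b') + (1 - a) * (1 - c) * (b + b')| ≤ 2 := by
    have h1 : 0 ≤ a * c := mul_nonneg ha hc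
    have h2 : 0 ≤ (1 - a) * (1 - c) := mul_nonneg (by linarith) (by linarith)
    have h3 : a * c + (1 - a) * (1 - c) ≤ 1 := by nlinarith
    rw [abs_le]
    constructor <;> nlinarith
  have hP' : |a * (1 - b') ^ 2 + (1 - a) * b' ^ 2| ≤ 1 := by
    have h1 : (1 - b') ^ 2 ≤ 1 := by nlinarith
    have h2 : b' ^ 2 ≤ 1 := by nlinarith
    rw [abs_le]
    constructor <;> nlinarith [sq_nonneg (1 - b'), sq_nonneg b']
  calc |a - a'| * (c' * (1 - b') ^ 2 + (1 - c') * b' ^ 2)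
      = |(a - a') * (c' * (1 - b') ^ 2 + (1 - c') * b' ^ 2)| := by rw [abs_mul, abs_of_nonneg hQ]
    _ ≤ |b - b'| * |a * c * (2 - b - b') + (1 - a) * (1 - c) * (b + b')| +
        |c - c'| * |a * (1 - b') ^ 2 + (1 - a) * b' ^ 2| := by
      rw [key, ← abs_mul, ← abs_mul]
      exact abs_sub _ _
    _ ≤ |b - b'| * 2 + |c - c'| * 1 := by gcongr
    _ = _ := by ring

end Binomial

/-! ### Block matrices: lower bound for the number of tables, upper bound for the tilted sum. -/

section Blocks

variable {k n : ℕ}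

/-- The two-block vector `(x, …, x, y, …, y)`. -/
def twoBlock {α : Type*} (k n : ℕ) (x y : α) : Fin (k + n) → α :=
  Fin.append (fun _ => x) fun _ => y

@[simp] theorem twoBlock_castAdd {α : Type*} (x y : α) (i : Fin k) :
    twoBlock k n x y (Fin.castAdd n i) = x := by simp [twoBlock]

@[simp] theorem twoBlock_natAdd {α : Type*} (x y : α) (i : Fin n) :
    twoBlock k n x y (Fin.natAdd k i) = y := by simp [twoBlock]

/-- Tables of the four blocks fit together to a table of the whole. -/
theorem card_mul_card_le_card_tableFinset (r₁ r₂ : Fin k → ℕ) (r₃ r₄ : Fin n → ℕ)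
    (c₁ c₃ : Fin k → ℕ) (c₂ c₄ : Fin n → ℕ) {r c : Fin (k + n) → ℕ}
    (hr : r = Fin.append (r₁ + r₂) (r₃ + r₄)) (hc : c = Fin.append (c₁ + c₃) (c₂ + c₄)) :
    (tableFinset r₁ c₁).card * (tableFinset r₂ c₂).card *
      ((tableFinset r₃ c₃).card * (tableFinset r₄ c₄).card) ≤ (tableFinset r c).card := by
  simp only [← Finset.card_product]
  refine Finset.card_le_card_of_injOn (fun A => Fin.append
    (fun i => Fin.append (A.1.1 i) (A.1.2 i)) fun i => Fin.append (A.2.1 i) (A.2.2 i)) ?_ ?_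
  · rintro ⟨⟨A₁, A₂⟩, A₃, A₄⟩ hA
    simp only [Finset.coe_product, Set.mem_prod, Finset.mem_coe, mem_tableFinset] at hA
    obtain ⟨⟨⟨h1, h1r, h1c⟩, h2, h2r, h2c⟩, ⟨h3, h3r, h3c⟩, h4, h4r, h4c⟩ := hA
    rw [Finset.mem_coe, mem_tableFinset, hr, hc]
    refine ⟨fun i j => ?_, fun i => ?_, fun j => ?_⟩
    · refine Fin.addCases (fun i => ?_) (fun i => ?_) i <;>
        refine Fin.addCases (fun j => ?_) (fun j => ?_) j <;> simp_all
    · refine Fin.addCases (fun i => ?_) (fun i => ?_) i <;> simp_all [Fin.sum_univ_add]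
    · refine Fin.addCases (fun i => ?_) (fun i => ?_) j <;> simp_all [Fin.sum_univ_add]
  · rintro ⟨⟨A₁, A₂⟩, A₃, A₄⟩ - ⟨⟨B₁, B₂⟩, B₃, B₄⟩ - hAB
    have h : ∀ i j, _ := fun i j => congrFun (congrFun hAB i) j
    have e1 : A₁ = B₁ := by
      funext i j; simpa using h (Fin.castAdd n i) (Fin.castAdd n j)
    have e2 : A₂ = B₂ := by
      funext i j; simpa using h (Fin.castAdd n i) (Fin.natAdd k j)
    have e3 : A₃ = B₃ := by
      funext i j; simpa using h (Fin.natAdd k i) (Fin.castAdd n j)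
    have e4 : A₄ = B₄ := by
      funext i j; simpa using h (Fin.natAdd k i) (Fin.natAdd k j)
    rw [e1, e2, e3, e4]

theorem exists_balanced (hn : 0 < n) (t : ℕ) :
    ∃ c : Fin n → ℕ, ∑ j, c j = t ∧ (∀ j, t / n ≤ c j) ∧ ∀ j, c j ≤ t / n + 1 := by
  refine ⟨fun j => t / n + if (j : ℕ) < t % n then 1 else 0, ?_, fun j => by simp, fun j => ?_⟩
  · have h : (Finset.univ.filter fun j : Fin n => (j : ℕ) < t % n).card = t % n := by
      rw [Fin.card_filter_val_lt, min_eq_right (Nat.mod_lt t hn).le]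
    rw [Finset.sum_add_distrib, ← Finset.card_filter, h]
    simp [Nat.div_add_mod]
  · dsimp only
    split_ifs <;> omega

/-- Give the corner all margins `d`, the side blocks `R - d` against a balanced vector `c`, and the
last block `S - c j`. All four margins are balanced; `k + 1 ≤ S` keeps `S - c j` an honest
difference. Each block loses a factor at most `(n + 1) ^ (2 * n)`. -/
theorem choose_prod_le_card_tableFinset {d R S : ℕ} (hn : 0 < n) (hkn : k ≤ n) (hdR : d ≤ R)
    (hRn : R - d ≤ n) (hS : k + 1 ≤ S) :
    (k * k).choose (k * d) * ((k * n).choose (k * (R - d)) * (k * n).choose (k * (R - d))) *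
        (n * n).choose (n * S - k * (R - d)) ≤
      (n + 1) ^ (8 * n) * (tableFinset (twoBlock k n R S) (twoBlock k n R S)).card := by
  obtain ⟨c, hcs, hcl, hcu⟩ := exists_balanced hn (k * (R - d))
  have hdiv : k * (R - d) / n ≤ k := Nat.div_le_of_le_mul (by
    rw [mul_comm n k]; exact Nat.mul_le_mul_left k hRn)
  have hcS : ∀ j, c j ≤ S := fun j => by have := hcu j; omega
  have hbal : ∀ j j', c j ≤ c j' + 1 := fun j j' => by
    have := hcu j; have := hcl j'; omega
  have hbal' : ∀ j j', S - c j ≤ S - c j' + 1 := fun j j' => by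
    have := hbal j' j; omega
  have hsum' : ∑ j, (S - c j) = n * S - k * (R - d) := by
    have : ∑ j, (S - c j) + ∑ j, c j = n * S := by
      rw [← Finset.sum_add_distrib, Finset.sum_congr rfl fun j _ => Nat.sub_add_cancel (hcS j)]
      simp
    omega
  have h1 := choose_le_card_tableFinset (I := Fin k) (J := Fin k) (r := fun _ => d)
    (c := fun _ => d) (s := k * d) (by simp) (by simp) (by simp) (by simp)
  have h2 := choose_le_card_tableFinset (I := Fin k) (r := fun _ => R - d) (c := c)
    (by simp) hbal (by simp) hcs
  have h3 := choose_le_card_tableFinset (J := Fin k) (r := c) (c := fun _ => R - d)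
    hbal (by simp) hcs (by simp)
  have h4 := choose_le_card_tableFinset (r := fun j => S - c j) (c := fun j => S - c j)
    hbal' hbal' hsum' hsum'
  have h5 := card_mul_card_le_card_tableFinset (fun _ : Fin k => d) (fun _ => R - d) c
    (fun j => S - c j) (fun _ => d) (fun _ => R - d) c (fun j => S - c j)
    (r := twoBlock k n R S) (c := twoBlock k n R S)
    (by rw [twoBlock]; congr 1 <;> funext i
        · simp [hdR]
        · simp [hcS])
    (by rw [twoBlock]; congr 1 <;> funext i
        · simp [hdR]
        · simp [hcS])
  simp only [Fintype.card_fin] at h1 h2 h3 h4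
  have hpow : ∀ a b c d : ℕ, a ≤ n → b ≤ n → c ≤ n → d ≤ n →
      (a + 1) ^ b * (c + 1) ^ d ≤ (n + 1) ^ (2 * n) := by
    intro a b c d ha hb hc hd
    calc (a + 1) ^ b * (c + 1) ^ d ≤ (n + 1) ^ n * (n + 1) ^ n := by
          refine Nat.mul_le_mul ?_ ?_
          · exact (Nat.pow_le_pow_left (by omega) _).trans (Nat.pow_le_pow_right (by omega) hb)
          · exact (Nat.pow_le_pow_left (by omega) _).trans (Nat.pow_le_pow_right (by omega) hd)
      _ = _ := by rw [← pow_add, two_mul]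
  replace h1 := h1.trans (Nat.mul_le_mul_right _ (hpow k k k k hkn hkn hkn hkn))
  replace h2 := h2.trans (Nat.mul_le_mul_right _ (hpow n k k n le_rfl hkn hkn le_rfl))
  replace h3 := h3.trans (Nat.mul_le_mul_right _ (hpow k n n k hkn le_rfl le_rfl hkn))
  replace h4 := h4.trans (Nat.mul_le_mul_right _ (hpow n n n n le_rfl le_rfl le_rfl le_rfl))
  rw [mul_comm n k] at h3
  refine (Nat.mul_le_mul (Nat.mul_le_mul h1 (Nat.mul_le_mul h2 h3)) h4).trans
    (le_trans (le_of_eq ?_) (Nat.mul_le_mul_left _ h5))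
  rw [show 8 * n = 2 * n + 2 * n + 2 * n + 2 * n by ring]
  simp only [pow_add]
  ring

theorem tableFinset_twoBlock_nonempty {R S : ℕ} (hn : 0 < n) (hkn : k ≤ n) (hRn : R ≤ n)
    (hS : k + 1 ≤ S) (hSn : S ≤ n) :
    (tableFinset (twoBlock k n R S) (twoBlock k n R S)).Nonempty := by
  have h := choose_prod_le_card_tableFinset (d := 0) hn hkn (Nat.zero_le R) (by simpa using hRn) hS
  rw [← Finset.card_pos]
  refine Nat.pos_of_mul_pos_left (lt_of_lt_of_le ?_ h)
  have h1 : k * R ≤ k * n := Nat.mul_le_mul_left _ hRn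
  have h2 : n * S ≤ n * n := Nat.mul_le_mul_left _ hSn
  simp only [mul_zero, Nat.choose_zero_right, one_mul, Nat.sub_zero]
  exact Nat.mul_pos (Nat.mul_pos (Nat.choose_pos h1) (Nat.choose_pos h1))
    (Nat.choose_pos (by omega))

/-- A deviation of order `√M` from the mean costs only a constant factor. -/
theorem one_le_choose_mul_exp {s t M K : ℕ} (h : s + t = M) {a η : ℝ} (ha : 0 < a) (ha' : a < 1)
    (hη : 0 < η) (hηa : η ≤ a * (1 - a)) (hM : K * K ≤ M) (hs : |s - a * M| ≤ K) :
    1 ≤ (M + 1) * (M.choose s * (a ^ s * (1 - a) ^ t)) * Real.exp (1 / η) := by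
  refine (one_le_choose_mul_pow_mul_exp h ha ha').trans ?_
  have hb : 0 < 1 - a := by linarith
  refine mul_le_mul_of_nonneg_left (Real.exp_le_exp.2 ?_) (by positivity)
  have hM' : (K : ℝ) * K ≤ M := by exact_mod_cast hM
  have h1 : ((s : ℝ) - a * M) ^ 2 ≤ M := by
    rw [← sq_abs, sq]
    exact (mul_le_mul hs hs (abs_nonneg _) (Nat.cast_nonneg _)).trans hM'
  rcases (Nat.cast_nonneg M : (0 : ℝ) ≤ M).eq_or_lt with h0 | h0
  · rw [← h0]; simp; exact hη.le
  · rw [div_le_div_iff₀ (by positivity) hη]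
    nlinarith

theorem one_sub_add_mul_exp {a : ℝ} (ha' : a < 1) (l : ℝ) :
    1 + a / (1 - a) * Real.exp l = (1 - a + a * Real.exp l) / (1 - a) := by
  have : 1 - a ≠ 0 := by linarith
  field_simp

/-- The sum of the entries of the upper left block. -/
def cornerSum (D : Fin (k + n) → Fin (k + n) → ℕ) : ℕ :=
  ∑ i : Fin k, ∑ j : Fin k, D (Fin.castAdd n i) (Fin.castAdd n j)

/-- The second factor on the left is the Bernoulli weight shared by all tables, written through any
block counts `s`, `t` compatible with the margins. Only the corner is tilted by `l`, so only its
moment generating function survives. -/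
theorem sum_exp_cornerSum_le {R S : ℕ} {a b c l : ℝ} (ha : 0 < a) (ha' : a < 1) (hb : 0 < b)
    (hb' : b < 1) (hc : 0 < c) (hc' : c < 1)
    (hodds : a * c * (1 - b) ^ 2 = (1 - a) * (1 - c) * b ^ 2) (hl : |l| ≤ 1)
    {s₁ s₂ s₄ t₁ t₂ t₄ : ℕ} (h1 : s₁ + t₁ = k * k) (h2 : s₂ + t₂ = k * n) (h4 : s₄ + t₄ = n * n)
    (h12 : s₁ + s₂ = k * R) (h24 : s₂ + s₄ = n * S) :
    (∑ D ∈ tableFinset (twoBlock k n R S) (twoBlock k n R S), Real.exp (l * cornerSum D)) *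
        ((a ^ s₁ * (1 - a) ^ t₁) * ((b ^ s₂ * (1 - b) ^ t₂) * (b ^ s₂ * (1 - b) ^ t₂)) *
          (c ^ s₄ * (1 - c) ^ t₄)) ≤
      Real.exp ((k * k) * (a * l + l ^ 2)) := by
  have ha1 : 0 < 1 - a := by linarith
  have hb1 : 0 < 1 - b := by linarith
  have hc1 : 0 < 1 - c := by linarith
  set α := Real.log (a / (1 - a)) with hα
  set γ := Real.log (c / (1 - c)) with hγ
  have eα : Real.exp α = a / (1 - a) := Real.exp_log (by positivity)
  have eγ : Real.exp γ = c / (1 - c) := Real.exp_log (by positivity)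
  -- This is where the odds equation enters: the side log-odds are the average of those of the
  -- diagonal blocks.
  have eβ : Real.exp (α / 2 + γ / 2) = b / (1 - b) := by
    have h : Real.exp (α / 2 + γ / 2) ^ 2 = (b / (1 - b)) ^ 2 := by
      rw [← Real.exp_nat_mul, show ((2 : ℕ) : ℝ) * (α / 2 + γ / 2) = α + γ by push_cast; ring,
        Real.exp_add, eα, eγ]
      field_simp
      linarith
    exact (pow_left_inj₀ (Real.exp_pos _).le (by positivity) two_ne_zero).1 h
  have key := sum_exp_tableFinset_le (twoBlock k n R S) (twoBlock k n R S)
    (twoBlock k n (α / 2) (γ / 2)) (twoBlock k n (α / 2) (γ / 2))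
    (fun i j => l * (twoBlock k n 1 0 i * twoBlock k n 1 0 j))
  simp only [Fin.sum_univ_add, Fin.prod_univ_add, twoBlock_castAdd, twoBlock_natAdd, mul_one,
    mul_zero, zero_mul, Finset.sum_const_zero, add_zero, Finset.sum_const, Finset.prod_const,
    Finset.card_univ, Fintype.card_fin, nsmul_eq_mul] at key
  rw [add_comm (γ / 2) (α / 2), Real.exp_add _ l, add_halves, add_halves, eα, eβ, eγ,
    one_sub_add_mul_exp ha'] at key
  have hcs : ∀ D : Fin (k + n) → Fin (k + n) → ℕ, l * (cornerSum D : ℝ) =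
      ∑ i : Fin k, ∑ j : Fin k, l * (D (Fin.castAdd n i) (Fin.castAdd n j) : ℝ) := by
    intro D
    simp [cornerSum, Finset.mul_sum]
  simp_rw [hcs]
  have e12 : (s₁ : ℝ) + s₂ = k * R := by exact_mod_cast h12
  have e24 : (s₂ : ℝ) + s₄ = n * S := by exact_mod_cast h24
  have hexp : (a / (1 - a)) ^ s₁ * ((b / (1 - b)) ^ s₂ * (b / (1 - b)) ^ s₂) *
      (c / (1 - c)) ^ s₄ = Real.exp (k * (α / 2 * R) + n * (γ / 2 * S) +
        (k * (α / 2 * R) + n * (γ / 2 * S))) := by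
    rw [← eα, ← eβ, ← eγ, ← Real.exp_nat_mul, ← Real.exp_nat_mul, ← Real.exp_nat_mul,
      ← Real.exp_add, ← Real.exp_add, ← Real.exp_add]
    congr 1
    linear_combination α * e12 + γ * e24
  rw [← hexp] at key
  have hz : ∀ x : ℝ, 0 < 1 - x → 1 + x / (1 - x) = 1 / (1 - x) := fun x hx => by
    field_simp; ring
  rw [hz b hb1, hz c hc1] at key
  have hw : (a ^ s₁ * (1 - a) ^ t₁) * ((b ^ s₂ * (1 - b) ^ t₂) * (b ^ s₂ * (1 - b) ^ t₂)) *
          (c ^ s₄ * (1 - c) ^ t₄) =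
      (a / (1 - a)) ^ s₁ * ((b / (1 - b)) ^ s₂ * (b / (1 - b)) ^ s₂) * (c / (1 - c)) ^ s₄ *
        ((1 - a) ^ (k * k) * ((1 - b) ^ (k * n) * (1 - b) ^ (k * n)) * (1 - c) ^ (n * n)) := by
    rw [← h1, ← h2, ← h4]
    simp only [div_pow, pow_add]
    field_simp
  rw [hw, ← mul_assoc]
  refine (mul_le_mul_of_nonneg_right key (by positivity)).trans ?_
  have hm := bernoulli_mgf_le ha.le ha'.le hl
  have hpos : 0 ≤ 1 - a + a * Real.exp l := by positivity
  calc _ = (1 - a + a * Real.exp l) ^ (k * k) := by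
        simp only [mul_pow, div_pow, one_pow, ← pow_mul, mul_comm n k]
        field_simp
    _ ≤ Real.exp (a * l + l ^ 2) ^ (k * k) := by gcongr
    _ = _ := by rw [← Real.exp_nat_mul]; push_cast; rfl

end Blocks

/-! ### The mean of the corner sum. -/

section Corner

variable {k n : ℕ}

theorem mean_cornerSum_mul_le {R S d : ℕ} {a b c η l : ℝ} (hn : 0 < n) (hkn : k ≤ n)
    (hRn : R ≤ n) (hS : k + 1 ≤ S) (hSn : S ≤ n) (hdk : d ≤ k) (hdR : d ≤ R)
    (hd : |(d : ℝ) - a * k| ≤ 1) (ha : 0 < a) (ha' : a < 1) (hb : 0 < b)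
    (hb' : b < 1) (hc : 0 < c) (hc' : c < 1) (hη : 0 < η) (hηa : η ≤ a * (1 - a))
    (hηb : η ≤ b * (1 - b)) (hηc : η ≤ c * (1 - c)) (hR : a * k + b * n = R)
    (hSeq : b * k + c * n = S) (hodds : a * c * (1 - b) ^ 2 = (1 - a) * (1 - c) * b ^ 2)
    (hl : |l| ≤ 1) :
    l * ((∑ D ∈ tableFinset (twoBlock k n R S) (twoBlock k n R S), (cornerSum D : ℝ)) /
        (tableFinset (twoBlock k n R S) (twoBlock k n R S)).card) ≤
      (k * k) * (a * l + l ^ 2) + ((8 * n + 8) * Real.log (n + 1) + 4 / η) := by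
  set T := tableFinset (twoBlock k n R S) (twoBlock k n R S) with hT
  have hTne : T.Nonempty := tableFinset_twoBlock_nonempty hn hkn hRn hS hSn
  obtain ⟨u, hu⟩ := Nat.exists_eq_add_of_le hdk
  obtain ⟨e, he⟩ := Nat.exists_eq_add_of_le hdR
  have hRd : R - d = e := by omega
  have hen : e ≤ n := by omega
  obtain ⟨f, hf⟩ := Nat.exists_eq_add_of_le hen
  have h1 : k * d + k * u = k * k := by rw [← mul_add, ← hu]
  have h2 : k * e + k * f = k * n := by rw [← mul_add, ← hf]
  have hke : k * e ≤ n * S := by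
    calc k * e ≤ k * n := Nat.mul_le_mul_left _ hen
      _ = n * k := mul_comm _ _
      _ ≤ n * S := Nat.mul_le_mul_left _ (by omega)
  have hnS : n * S ≤ n * n := Nat.mul_le_mul_left _ hSn
  have h4 : (n * S - k * e) + (n * n - (n * S - k * e)) = n * n := by omega
  have h12 : k * d + k * e = k * R := by rw [← mul_add, ← he]
  have h24 : k * e + (n * S - k * e) = n * S := by omega
  have hup := sum_exp_cornerSum_le (k := k) (n := n) ha ha' hb hb' hc hc' hodds hl h1 h2 h4 h12 h24
  have hlow := choose_prod_le_card_tableFinset (S := S) hn hkn hdR (by omega) hS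
  rw [hRd, ← hT] at hlow
  rw [← hT] at hup
  have hk0 : (0 : ℝ) ≤ k := Nat.cast_nonneg k
  have hdev : |(k : ℝ) * d - a * (k * k)| ≤ k := by
    rw [show (k : ℝ) * d - a * (k * k) = k * (d - a * k) by ring, abs_mul, abs_of_nonneg hk0]
    exact mul_le_of_le_one_right hk0 hd
  have heR : (e : ℝ) = R - d := by rw [he]; push_cast; ring
  -- Since `a`, `b`, `c` solve the margin equations exactly, rounding `a * k` to `d` is the only
  -- source of error: in every block the count is off by `± k (d - a k)`.
  have hdev2 : |(k : ℝ) * e - b * (k * n)| ≤ k := by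
    rw [← abs_neg]
    convert hdev using 2
    rw [heR]
    linear_combination (k : ℝ) * hR
  have hs4 : ((n * S - k * e : ℕ) : ℝ) = n * S - k * e := by
    rw [Nat.cast_sub hke]; push_cast; ring
  have hdev4 : |((n * S - k * e : ℕ) : ℝ) - c * (n * n)| ≤ k := by
    convert hdev using 2
    rw [hs4, heR]
    linear_combination (k : ℝ) * hR - (n : ℝ) * hSeq
  have l1 := one_le_choose_mul_exp h1 ha ha' hη hηa le_rfl (by push_cast; exact hdev)
  have l2 := one_le_choose_mul_exp h2 hb hb' hη hηb (Nat.mul_le_mul_left k hkn)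
    (by push_cast; exact hdev2)
  have l4 := one_le_choose_mul_exp h4 hc hc' hη hηc (Nat.mul_le_mul hkn hkn)
    (by push_cast [-Nat.cast_sub]; exact hdev4)
  have ha1 : 0 < 1 - a := by linarith
  have hb1 : 0 < 1 - b := by linarith
  have hc1 : 0 < 1 - c := by linarith
  set w1 := a ^ (k * d) * (1 - a) ^ (k * u) with hw1
  set w2 := b ^ (k * e) * (1 - b) ^ (k * f) with hw2
  set w4 := c ^ (n * S - k * e) * (1 - c) ^ (n * n - (n * S - k * e)) with hw4
  have w1pos : 0 < w1 := by positivity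
  have w2pos : 0 < w2 := by positivity
  have w4pos : 0 < w4 := by positivity
  set E := Real.exp (1 / η) with hE
  have hEpos : 0 < E := Real.exp_pos _
  have hM : ∀ p q : ℕ, p ≤ n → q ≤ n → (((p * q : ℕ) : ℝ) + 1) ≤ ((n : ℝ) + 1) ^ 2 := by
    intro p q hp hq
    have : p * q + 1 ≤ (n + 1) ^ 2 := by nlinarith [Nat.mul_le_mul hp hq]
    exact_mod_cast this
  set c1 : ℝ := ((k * k).choose (k * d) : ℝ) with hc1d
  set c2 : ℝ := ((k * n).choose (k * e) : ℝ) with hc2d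
  set c4 : ℝ := ((n * n).choose (n * S - k * e) : ℝ) with hc4d
  have hlow' : c1 * (c2 * c2) * c4 ≤ ((n : ℝ) + 1) ^ (8 * n) * T.card := by
    have h := (Nat.cast_le (α := ℝ)).2 hlow
    push_cast at h
    exact h
  set q : ℝ := (n : ℝ) + 1 with hq
  have hq0 : 0 < q := by positivity
  replace l1 : 1 ≤ q ^ 2 * (c1 * w1) * E := l1.trans (by gcongr; exact hM k k hkn hkn)
  replace l2 : 1 ≤ q ^ 2 * (c2 * w2) * E := l2.trans (by gcongr; exact hM k n hkn le_rfl)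
  replace l4 : 1 ≤ q ^ 2 * (c4 * w4) * E := l4.trans (by gcongr; exact hM n n le_rfl le_rfl)
  -- `8 * n` comes from the margin counts, `8` from the factors `M + 1 ≤ q ^ 2` of the four blocks.
  have hone : 1 ≤ q ^ (8 * n + 8) * E ^ 4 * (T.card * (w1 * (w2 * w2) * w4)) := by
    calc 1 ≤ (q ^ 2 * (c1 * w1) * E) * ((q ^ 2 * (c2 * w2) * E) * (q ^ 2 * (c2 * w2) * E)) *
          (q ^ 2 * (c4 * w4) * E) :=
        one_le_mul_of_one_le_of_one_le (one_le_mul_of_one_le_of_one_le l1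
          (one_le_mul_of_one_le_of_one_le l2 l2)) l4
      _ = q ^ 8 * E ^ 4 * (w1 * (w2 * w2) * w4) * (c1 * (c2 * c2) * c4) := by ring
      _ ≤ q ^ 8 * E ^ 4 * (w1 * (w2 * w2) * w4) * (q ^ (8 * n) * T.card) := by gcongr
      _ = _ := by ring
  have hjen := card_mul_exp_mean_le hTne (fun D => l * (cornerSum D : ℝ))
  rw [← Finset.mul_sum, mul_div_assoc] at hjen
  set m := l * ((∑ D ∈ T, (cornerSum D : ℝ)) / T.card) with hm
  have hfin : Real.exp m ≤ q ^ (8 * n + 8) * E ^ 4 * Real.exp (k * k * (a * l + l ^ 2)) := by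
    calc Real.exp m = Real.exp m * 1 := (mul_one _).symm
      _ ≤ Real.exp m * (q ^ (8 * n + 8) * E ^ 4 * (T.card * (w1 * (w2 * w2) * w4))) := by gcongr
      _ = q ^ (8 * n + 8) * E ^ 4 * ((T.card * Real.exp m) * (w1 * (w2 * w2) * w4)) := by ring
      _ ≤ q ^ (8 * n + 8) * E ^ 4 *
          ((∑ D ∈ T, Real.exp (l * cornerSum D)) * (w1 * (w2 * w2) * w4)) := by gcongr
      _ ≤ _ := by gcongr
  have hqexp : q ^ (8 * n + 8) = Real.exp ((8 * n + 8) * Real.log q) := by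
    rw [← Real.exp_log hq0, ← Real.exp_nat_mul, Real.log_exp]
    push_cast
    rfl
  rw [hqexp, hE, ← Real.exp_nat_mul, ← Real.exp_add, ← Real.exp_add, Real.exp_le_exp] at hfin
  refine hfin.trans (le_of_eq ?_)
  push_cast
  ring

/-- The tilts `l = μ` and `l = -μ` give the two sides, after division by `μ`. -/
theorem abs_mean_cornerSum_sub_le {R S d : ℕ} {a b c η μ : ℝ} (hn : 0 < n) (hkn : k ≤ n)
    (hRn : R ≤ n) (hS : k + 1 ≤ S) (hSn : S ≤ n) (hdk : d ≤ k) (hdR : d ≤ R)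
    (hd : |(d : ℝ) - a * k| ≤ 1) (ha : 0 < a) (ha' : a < 1) (hb : 0 < b)
    (hb' : b < 1) (hc : 0 < c) (hc' : c < 1) (hη : 0 < η) (hηa : η ≤ a * (1 - a))
    (hηb : η ≤ b * (1 - b)) (hηc : η ≤ c * (1 - c)) (hR : a * k + b * n = R)
    (hSeq : b * k + c * n = S) (hodds : a * c * (1 - b) ^ 2 = (1 - a) * (1 - c) * b ^ 2)
    (hμ : 0 < μ) (hμ1 : μ ≤ 1) :
    |(∑ D ∈ tableFinset (twoBlock k n R S) (twoBlock k n R S), (cornerSum D : ℝ)) /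
        (tableFinset (twoBlock k n R S) (twoBlock k n R S)).card - a * (k * k)| ≤
      μ * (k * k) + ((8 * n + 8) * Real.log (n + 1) + 4 / η) / μ := by
  have h1 := mean_cornerSum_mul_le (l := μ) hn hkn hRn hS hSn hdk hdR hd ha ha' hb hb' hc hc' hη
    hηa hηb hηc hR hSeq hodds (by rw [abs_of_pos hμ]; exact hμ1)
  have h2 := mean_cornerSum_mul_le (l := -μ) hn hkn hRn hS hSn hdk hdR hd ha ha' hb hb' hc hc' hη
    hηa hηb hηc hR hSeq hodds (by rw [abs_neg, abs_of_pos hμ]; exact hμ1)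
  set m := (∑ D ∈ tableFinset (twoBlock k n R S) (twoBlock k n R S), (cornerSum D : ℝ)) /
        (tableFinset (twoBlock k n R S) (twoBlock k n R S)).card
  set L := (8 * n + 8) * Real.log (n + 1) + 4 / η
  have h3 : L / μ * μ = L := div_mul_cancel₀ _ hμ.ne'
  rw [abs_le]
  constructor <;> refine le_of_mul_le_mul_left ?_ hμ <;> nlinarith

end Corner

/-! ### Symmetries of the entry laws and reduction of total variation to means. -/

section Laws

theorem blockMargin_eq_twoBlock (n : ℕ) (δ B C : ℝ) :
    blockMargin n δ B C = twoBlock (blockSize n δ) n ⌊B * C * n⌋₊ ⌊C * n⌋₊ := by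
  funext i
  refine Fin.addCases (fun i => ?_) (fun i => ?_) i
  · simp [blockMargin]
  · simp [blockMargin]

/-- The tables with block margins, as a finite set. -/
noncomputable def blockTableFinset (n : ℕ) (δ B C : ℝ) :
    Finset (Fin (blockSize n δ + n) → Fin (blockSize n δ + n) → ℕ) :=
  tableFinset (twoBlock (blockSize n δ) n ⌊B * C * n⌋₊ ⌊C * n⌋₊)
    (twoBlock (blockSize n δ) n ⌊B * C * n⌋₊ ⌊C * n⌋₊)

theorem coe_blockTableFinset (n : ℕ) (δ B C : ℝ) :
    (blockTableFinset n δ B C : Set _) = blockTables n δ B C := by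
  ext D
  rw [Finset.mem_coe, blockTableFinset, mem_tableFinset, blockTables, blockMargin_eq_twoBlock]
  rfl

theorem entry_succ {N : ℕ} (D : Fin N → Fin N → ℕ) (i j : Fin N) :
    entry D (i + 1) (j + 1) = D i j := by
  have hi := i.isLt
  have hj := j.isLt
  rw [entry, dif_pos (by omega)]
  rfl

theorem entry_transpose {N : ℕ} (D : Fin N → Fin N → ℕ) (i j : ℕ) :
    entry (fun a b => D b a) i j = entry D j i := by
  unfold entry
  split_ifs with h1 h2 h2
  · rfl
  · exact absurd h1.symm h2
  · exact absurd h2.symm h1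
  · rfl

theorem map_uniformOn_comp_equiv {Ω Ω' : Type*} [MeasurableSpace Ω] [DiscreteMeasurableSpace Ω]
    [MeasurableSpace Ω'] (S : Set Ω) (e : Ω ≃ Ω) (he : ∀ x, e x ∈ S ↔ x ∈ S) (f : Ω → Ω') :
    (uniformOn S).map (fun x => f (e x)) = (uniformOn S).map f := by
  ext A hA
  rw [Measure.map_apply .of_discrete hA, Measure.map_apply .of_discrete hA, uniformOn,
    cond_apply .of_discrete, cond_apply .of_discrete, Measure.count_apply .of_discrete,
    Measure.count_apply .of_discrete, Measure.count_apply .of_discrete,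
    ← Set.encard_preimage_of_bijective e.bijective (S ∩ f ⁻¹' A)]
  congr 3
  ext x
  simp [he]

/-- Swapping two rows and two columns within their blocks permutes the tables. -/
theorem entryLaw_eq_of_block (n : ℕ) (δ B C : ℝ) (i j i' j' : Fin (blockSize n δ + n))
    (hi : (i : ℕ) < blockSize n δ ↔ (i' : ℕ) < blockSize n δ)
    (hj : (j : ℕ) < blockSize n δ ↔ (j' : ℕ) < blockSize n δ) :
    entryLaw n δ B C (i + 1) (j + 1) = entryLaw n δ B C (i' + 1) (j' + 1) := by
  have hm : ∀ a b : Fin (blockSize n δ + n), ((a : ℕ) < blockSize n δ ↔ (b : ℕ) < blockSize n δ) →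
      ∀ l, blockMargin n δ B C (Equiv.swap a b l) = blockMargin n δ B C l := by
    intro a b hab l
    simp only [blockMargin]
    rcases eq_or_ne l a with rfl | h1
    · simp [hab]
    rcases eq_or_ne l b with rfl | h2
    · simp [hab]
    rw [Equiv.swap_apply_of_ne_of_ne h1 h2]
  let e : (Fin (blockSize n δ + n) → Fin (blockSize n δ + n) → ℕ) ≃
      (Fin (blockSize n δ + n) → Fin (blockSize n δ + n) → ℕ) :=
    Equiv.arrowCongr (Equiv.swap i i') (Equiv.arrowCongr (Equiv.swap j j') (Equiv.refl ℕ))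
  have heapp : ∀ D a b, e D a b = D (Equiv.swap i i' a) (Equiv.swap j j' b) := fun D a b => rfl
  have hmem : ∀ D, D ∈ blockTables n δ B C → e D ∈ blockTables n δ B C := by
    rintro D ⟨h1, h2, h3⟩
    refine ⟨fun a b => h1 _ _, fun a => ?_, fun b => ?_⟩
    · simp_rw [heapp]
      rw [Equiv.sum_comp (Equiv.swap j j') (fun b => D (Equiv.swap i i' a) b), h2, hm i i' hi]
    · simp_rw [heapp]
      rw [Equiv.sum_comp (Equiv.swap i i') (fun a => D a (Equiv.swap j j' b)), h3, hm j j' hj]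
  have hinv : ∀ D, e (e D) = D := by
    intro D
    funext a b
    simp [heapp]
  have h := map_uniformOn_comp_equiv (blockTables n δ B C) e
    (fun D => ⟨fun h => by simpa [hinv] using hmem _ h, hmem D⟩)
    (fun X => entry X (i + 1) (j + 1))
  simp only [entry_succ, heapp, Equiv.swap_apply_left] at h
  simp only [entryLaw, entry_succ]
  exact h.symm

theorem entryLaw_comm (n : ℕ) (δ B C : ℝ) (i j : ℕ) :
    entryLaw n δ B C i j = entryLaw n δ B C j i := by
  have h := map_uniformOn_comp_equiv (blockTables n δ B C)
    (Equiv.piComm fun _ _ => ℕ)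
    (fun D => ⟨fun h => ⟨fun a b => h.1 b a, h.2.2, h.2.1⟩,
      fun h => ⟨fun a b => h.1 b a, h.2.2, h.2.1⟩⟩) (fun X => entry X i j)
  rw [entryLaw, ← h, entryLaw]
  congr 1
  funext X
  exact entry_transpose X i j

theorem entryLaw_real_singleton (n : ℕ) (δ B C : ℝ) (i j : Fin (blockSize n δ + n)) (v : ℕ) :
    (entryLaw n δ B C (i + 1) (j + 1)).real {v} =
      ((blockTableFinset n δ B C).filter fun D => D i j = v).card /
        (blockTableFinset n δ B C).card := by
  classical
  simp only [entryLaw, entry_succ]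
  rw [map_measureReal_apply .of_discrete .of_discrete, measureReal_def,
    ← uniformOn_inter_self (by rw [← coe_blockTableFinset]; exact Finset.finite_toSet _),
    ← coe_blockTableFinset]
  have : (blockTableFinset n δ B C : Set (Fin (blockSize n δ + n) → Fin (blockSize n δ + n) → ℕ)) ∩
      (fun X => X i j) ⁻¹' {v} = ↑((blockTableFinset n δ B C).filter fun D => D i j = v) := by
    ext D; simp
  rw [this, uniformOn_apply_finset, Finset.inter_eq_right.2 (Finset.filter_subset _ _)]
  simp

theorem entryLaw_real_one (n : ℕ) (δ B C : ℝ) (i j : Fin (blockSize n δ + n)) :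
    (entryLaw n δ B C (i + 1) (j + 1)).real {1} =
      (∑ D ∈ blockTableFinset n δ B C, (D i j : ℝ)) / (blockTableFinset n δ B C).card := by
  rw [entryLaw_real_singleton, Finset.card_filter]
  push_cast
  congr 1
  refine Finset.sum_congr rfl fun D hD => ?_
  rcases (mem_tableFinset.1 hD).1 i j with h | h <;> simp [h]

/-- Both laws live on `{0, 1}`. Nonemptiness is needed for total mass one: `uniformOn` of the empty
set is the zero measure. -/
theorem tvDist_entryLaw_ber {n : ℕ} {δ B C : ℝ} (hne : (blockTableFinset n δ B C).Nonempty)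
    (i j : Fin (blockSize n δ + n)) (q : unitInterval) :
    tvDist (entryLaw n δ B C (i + 1) (j + 1)) (ber q) =
      2 * |(entryLaw n δ B C (i + 1) (j + 1)).real {1} - q| := by
  set T := blockTableFinset n δ B C with hT
  have hc : (T.card : ℝ) ≠ 0 := by exact_mod_cast hne.card_pos.ne'
  have hber : ∀ v : ℕ, (ber q).real {v} = if v = 1 then (q : ℝ) else if v = 0 then 1 - q else 0 := by
    intro v
    rw [ber, bernoulliMeasure_real_apply q (measurableSet_singleton v)]
    rcases eq_or_ne v 1 with rfl | h1
    · simp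
    rcases eq_or_ne v 0 with rfl | h2
    · simp
    simp [h1, h2, h1.symm, h2.symm]
  have hsupp : ∀ v ∉ ({0, 1} : Finset ℕ),
      |(entryLaw n δ B C (i + 1) (j + 1)).real {v} - (ber q).real {v}| = 0 := by
    intro v hv
    simp only [Finset.mem_insert, Finset.mem_singleton, not_or] at hv
    rw [hber, if_neg hv.2, if_neg hv.1, entryLaw_real_singleton, Finset.filter_false_of_mem]
    · simp
    · intro D hD
      have := (mem_tableFinset.1 hD).1 i j
      omega
  have h01 : (entryLaw n δ B C (i + 1) (j + 1)).real {0} =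
      1 - (entryLaw n δ B C (i + 1) (j + 1)).real {1} := by
    rw [entryLaw_real_singleton, entryLaw_real_singleton, eq_sub_iff_add_eq, ← add_div,
      div_eq_one_iff_eq hc]
    have h := Finset.card_filter_add_card_filter_not (s := T) (fun D => D i j = 0)
    have h' : (T.filter fun D => ¬ D i j = 0) = T.filter fun D => D i j = 1 := by
      refine Finset.filter_congr fun D hD => ?_
      have := (mem_tableFinset.1 hD).1 i j
      omega
    rw [h'] at h
    exact_mod_cast h
  rw [tvDist, tsum_eq_sum hsupp, Finset.sum_pair zero_ne_one, hber, hber, h01]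
  simp only [zero_ne_one, if_false, if_true]
  rw [show ∀ x y : ℝ, 1 - x - (1 - y) = -(x - y) by intros; ring, abs_neg, two_mul]

theorem entryLaw_real_one_mem {n : ℕ} {δ B C : ℝ} (i j : Fin (blockSize n δ + n)) :
    0 ≤ (entryLaw n δ B C (i + 1) (j + 1)).real {1} ∧
      (entryLaw n δ B C (i + 1) (j + 1)).real {1} ≤ 1 := by
  refine ⟨measureReal_nonneg, ?_⟩
  rw [entryLaw_real_singleton]
  exact div_le_one_of_le₀ (by exact_mod_cast Finset.card_filter_le _ _) (Nat.cast_nonneg _)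

/-- A row sum determines the mean entry in the columns of the second block up to `[n^δ] / n`. -/
theorem abs_mul_entryLaw_sub_le {n : ℕ} {δ B C : ℝ} (hne : (blockTableFinset n δ B C).Nonempty)
    (i j : Fin (blockSize n δ + n)) (hj : ¬ (j : ℕ) < blockSize n δ) :
    |n * (entryLaw n δ B C (i + 1) (j + 1)).real {1} - blockMargin n δ B C i| ≤
      blockSize n δ := by
  have hc : ((blockTableFinset n δ B C).card : ℝ) ≠ 0 := by exact_mod_cast hne.card_pos.ne'
  have hrow : ∑ l : Fin (blockSize n δ + n), (entryLaw n δ B C (i + 1) (l + 1)).real {1} =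
      blockMargin n δ B C i := by
    simp_rw [entryLaw_real_one]
    rw [← Finset.sum_div, Finset.sum_comm, div_eq_iff hc, blockMargin_eq_twoBlock]
    rw [Finset.sum_congr rfl fun D hD => by
      rw [← Nat.cast_sum, (mem_tableFinset.1 hD).2.1 i]]
    simp [mul_comm]
  rw [Fin.sum_univ_add] at hrow
  have h2 : ∀ l : Fin n, (entryLaw n δ B C (i + 1) (Fin.natAdd (blockSize n δ) l + 1)).real {1} =
      (entryLaw n δ B C (i + 1) (j + 1)).real {1} := fun l => by
    rw [entryLaw_eq_of_block n δ B C i (Fin.natAdd (blockSize n δ) l) i j Iff.rfl (by simpa using hj)]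
  rw [Finset.sum_congr rfl fun l _ => h2 l, Finset.sum_const, Finset.card_univ, Fintype.card_fin,
    nsmul_eq_mul] at hrow
  have h3 : 0 ≤ ∑ l : Fin (blockSize n δ),
      (entryLaw n δ B C (i + 1) (Fin.castAdd n l + 1)).real {1} :=
    Finset.sum_nonneg fun l _ => measureReal_nonneg
  have h4 : ∑ l : Fin (blockSize n δ),
      (entryLaw n δ B C (i + 1) (Fin.castAdd n l + 1)).real {1} ≤ blockSize n δ := by
    refine (Finset.sum_le_sum fun l _ => (entryLaw_real_one_mem i (Fin.castAdd n l)).2).trans ?_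
    simp
  rw [← hrow, abs_le]
  constructor <;> linarith

theorem mul_entryLaw_eq_mean_cornerSum {n : ℕ} {δ B C : ℝ} (i j : Fin (blockSize n δ + n))
    (hi : (i : ℕ) < blockSize n δ) (hj : (j : ℕ) < blockSize n δ) :
    (blockSize n δ * blockSize n δ : ℝ) * (entryLaw n δ B C (i + 1) (j + 1)).real {1} =
      (∑ D ∈ blockTableFinset n δ B C, (cornerSum D : ℝ)) / (blockTableFinset n δ B C).card := by
  have h : ∀ a b : Fin (blockSize n δ),
      (∑ D ∈ blockTableFinset n δ B C, (D (Fin.castAdd n a) (Fin.castAdd n b) : ℝ)) /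
        (blockTableFinset n δ B C).card = (entryLaw n δ B C (i + 1) (j + 1)).real {1} := by
    intro a b
    rw [← entryLaw_real_one, entryLaw_eq_of_block n δ B C _ _ i j (by simpa using hi)
      (by simpa using hj)]
  simp only [cornerSum, Nat.cast_sum]
  have h' : ∀ a : Fin (blockSize n δ), (∑ D ∈ blockTableFinset n δ B C, ∑ b : Fin (blockSize n δ),
      (D (Fin.castAdd n a) (Fin.castAdd n b) : ℝ)) / (blockTableFinset n δ B C).card =
      blockSize n δ * (entryLaw n δ B C (i + 1) (j + 1)).real {1} := by
    intro a
    rw [Finset.sum_comm, Finset.sum_div, Finset.sum_congr rfl fun b _ => h a b]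
    simp
  rw [Finset.sum_comm, Finset.sum_div, Finset.sum_congr rfl fun a _ => h' a]
  simp [mul_assoc]

end Laws

/-! ### Asymptotics in `n`. -/

section Asymptotic

theorem blockSize_le_rpow (n : ℕ) (δ : ℝ) : (blockSize n δ : ℝ) ≤ (n : ℝ) ^ δ :=
  Nat.floor_le (by positivity)

theorem one_le_blockSize {n : ℕ} {δ : ℝ} (hn : 1 ≤ n) (hδ : 0 ≤ δ) : 1 ≤ blockSize n δ :=
  Nat.le_floor (by exact_mod_cast Real.one_le_rpow (by exact_mod_cast hn) hδ)

theorem rpow_le_two_mul_blockSize {n : ℕ} {δ : ℝ} (hn : 1 ≤ n) (hδ : 0 ≤ δ) :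
    (n : ℝ) ^ δ ≤ 2 * blockSize n δ := by
  have h1 : (n : ℝ) ^ δ < blockSize n δ + 1 := Nat.lt_floor_add_one _
  have h2 : (1 : ℝ) ≤ blockSize n δ := by exact_mod_cast one_le_blockSize hn hδ
  linarith

theorem blockSize_le {n : ℕ} {δ : ℝ} (hn : 1 ≤ n) (hδ : δ ≤ 1) : blockSize n δ ≤ n := by
  have h : (blockSize n δ : ℝ) ≤ n := (blockSize_le_rpow n δ).trans
    ((Real.rpow_le_rpow_of_exponent_le (by exact_mod_cast hn) hδ).trans_eq (Real.rpow_one _))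
  exact_mod_cast h

theorem eventually_blockSize_add_two_le {δ : ℝ} (hδ : 0 ≤ δ) (hδ1 : δ < 1) {κ : ℝ} (hκ : 0 < κ) :
    ∀ᶠ n : ℕ in atTop, (blockSize n δ : ℝ) + 2 ≤ κ * n := by
  have h := (tendsto_rpow_neg_atTop (sub_pos.2 hδ1)).comp tendsto_natCast_atTop_atTop
  filter_upwards [h.eventually_le_const (show 0 < κ / 3 by positivity),
    eventually_ge_atTop 1] with n hn hn1
  have hn0 : (0 : ℝ) < n := by exact_mod_cast hn1
  have h1 : (1 : ℝ) ≤ (n : ℝ) ^ δ := Real.one_le_rpow (by exact_mod_cast hn1) hδ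
  have h2 : (n : ℝ) ^ δ = (n : ℝ) ^ (-(1 - δ)) * n := by
    rw [← Real.rpow_add_one hn0.ne']; congr 1; ring
  have h3 := blockSize_le_rpow n δ
  have h4 : (n : ℝ) ^ (-(1 - δ)) * n ≤ κ / 3 * n := by
    gcongr
    exact hn
  linarith

theorem abs_natFloor_sub_le {x : ℝ} (hx : 0 ≤ x) : |(⌊x⌋₊ : ℝ) - x| ≤ 1 := by
  have h1 := Nat.floor_le hx
  have h2 := Nat.lt_floor_add_one x
  rw [abs_le]
  constructor <;> linarith

theorem eventually_blockTableFinset_nonempty {δ B C : ℝ} (hC : 0 < C) (hδ : 0 ≤ δ)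
    (hδ1 : δ < 1) (hC1 : C < 1) (hBC : B ≤ 1 / C) :
    ∀ᶠ n : ℕ in atTop, (blockTableFinset n δ B C).Nonempty := by
  have hBC' : B * C ≤ 1 := by rwa [le_div_iff₀ hC] at hBC
  filter_upwards [eventually_blockSize_add_two_le hδ hδ1 hC, eventually_ge_atTop 1] with n hn hn1
  have hn0 : (0 : ℝ) < n := by exact_mod_cast hn1
  refine tableFinset_twoBlock_nonempty hn1 (blockSize_le hn1 hδ1.le) ?_ ?_ ?_
  · exact Nat.floor_le_of_le (by nlinarith)
  · exact Nat.le_floor (by push_cast; linarith)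
  · exact Nat.floor_le_of_le (by nlinarith)

/-- The total variation estimate for the blocks outside the upper left corner. -/
theorem tvDist_le_of_second_block {n : ℕ} {δ B C : ℝ} (hn : 1 ≤ n) (hδ : 0 ≤ δ)
    (hne : (blockTableFinset n δ B C).Nonempty) (q : unitInterval)
    (i j : Fin (blockSize n δ + n)) (hj : ¬ (j : ℕ) < blockSize n δ)
    (hi : |(blockMargin n δ B C i : ℝ) - q * n| ≤ 1) :
    tvDist (entryLaw n δ B C (i + 1) (j + 1)) (ber q) ≤ 4 * (n : ℝ) ^ (δ - 1) := by
  rw [tvDist_entryLaw_ber hne]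
  have hn0 : (0 : ℝ) < n := by exact_mod_cast hn
  set p := (entryLaw n δ B C (i + 1) (j + 1)).real {1}
  have h1 : |n * p - blockMargin n δ B C i| ≤ blockSize n δ := abs_mul_entryLaw_sub_le hne i j hj
  have h2 : |n * (p - q)| ≤ 2 * (n : ℝ) ^ δ := by
    calc |n * (p - q)| = |(n * p - blockMargin n δ B C i) + (blockMargin n δ B C i - q * n)| := by
          congr 1; ring
      _ ≤ blockSize n δ + 1 := (abs_add_le _ _).trans (add_le_add h1 hi)
      _ ≤ (n : ℝ) ^ δ + (n : ℝ) ^ δ := add_le_add (blockSize_le_rpow n δ)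
          (Real.one_le_rpow (by exact_mod_cast hn) hδ)
      _ = _ := by ring
  rw [abs_mul, abs_of_pos hn0] at h2
  rw [Real.rpow_sub_one hn0.ne', mul_div_assoc', le_div_iff₀ hn0]
  linarith

/-- The term `n ^ (δ - 1)` alone suffices; `n ^ e` is only a nonnegative summand, so `e` is
arbitrary. -/
theorem tvDist_isBigO_of_second_block {δ B C : ℝ} (hδ : 0 ≤ δ)
    (hne : ∀ᶠ n : ℕ in atTop, (blockTableFinset n δ B C).Nonempty) (q : unitInterval) (e : ℝ)
    (a b : ℕ → ℕ) (h : ∀ᶠ n : ℕ in atTop, ∃ i j : Fin (blockSize n δ + n),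
      a n = i + 1 ∧ b n = j + 1 ∧ ¬ (j : ℕ) < blockSize n δ ∧
        |(blockMargin n δ B C i : ℝ) - q * n| ≤ 1) :
    (fun n : ℕ => tvDist (entryLaw n δ B C (a n) (b n)) (ber q)) =O[atTop]
      fun n : ℕ => (n : ℝ) ^ (δ - 1) + (n : ℝ) ^ e := by
  refine IsBigO.of_bound 4 ?_
  filter_upwards [h, hne, eventually_ge_atTop 1] with n hn hne hn1
  obtain ⟨i, j, hi, hj, hj', him⟩ := hn
  rw [hi, hj, Real.norm_of_nonneg (show 0 ≤ tvDist _ _ from tsum_nonneg fun _ => abs_nonneg _),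
    Real.norm_of_nonneg (by positivity)]
  have h1 := tvDist_le_of_second_block hn1 hδ hne q i j hj' him
  have h2 : (0 : ℝ) ≤ (n : ℝ) ^ e := by positivity
  linarith

theorem sub_le_mul_one_sub {x y η : ℝ} (hx : 0 < x) (hx1 : x < 1) (hy : 0 < y) (hy1 : y < 1)
    (hxy : |x - y| ≤ η) (hη : 2 * η ≤ y * (1 - y)) : η ≤ x * (1 - x) := by
  have h1 : |(x - y) * (1 - x - y)| ≤ η * 1 := by
    rw [abs_mul]
    have : |1 - x - y| ≤ 1 := by rw [abs_le]; constructor <;> linarith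
    have h0 : 0 ≤ η := (abs_nonneg _).trans hxy
    gcongr
  have h2 : x * (1 - x) - y * (1 - y) = (x - y) * (1 - x - y) := by ring
  have h3 := (abs_le.1 h1).1
  linarith

theorem abs_sub_le_div_of_mul_add_mul_eq {k n m x x₀ y : ℝ} (hk : 0 ≤ k) (hn : 0 < n) (hy : 0 ≤ y)
    (hy1 : y ≤ 1) (h : y * k + x * n = m) (hm : |m - x₀ * n| ≤ 1) : |x - x₀| ≤ (k + 1) / n := by
  have h1 : |(x - x₀) * n| ≤ 1 + y * k := by
    rw [show (x - x₀) * n = (m - x₀ * n) + -(y * k) by linear_combination h]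
    refine (abs_add_le _ _).trans ?_
    rw [abs_neg, abs_of_nonneg (mul_nonneg hy hk)]
    linarith
  rw [abs_mul, abs_of_pos hn] at h1
  rw [le_div_iff₀ hn]
  nlinarith

/-- A quantitative estimate for the mean of the upper left block. -/
theorem abs_mean_cornerSum_div_sub_le {k n R S : ℕ} {a₀ b₀ c₀ η : ℝ} (hk : 0 < k) (hkn : k ≤ n)
    (hkR : k < R) (hRn : R < n) (hkS : k < S) (hSn : S < n) (ha : 0 < a₀) (ha' : a₀ < 1)
    (hb : 0 < b₀) (hb' : b₀ < 1) (hc : 0 < c₀) (hc' : c₀ < 1)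
    (hodds : a₀ * c₀ * (1 - b₀) ^ 2 = (1 - a₀) * (1 - c₀) * b₀ ^ 2) (hη : 0 < η)
    (hηa : 2 * η ≤ a₀ * (1 - a₀)) (hηb : 2 * η ≤ b₀ * (1 - b₀)) (hηc : 2 * η ≤ c₀ * (1 - c₀))
    (hR : |(R : ℝ) - b₀ * n| ≤ 1) (hS : |(S : ℝ) - c₀ * n| ≤ 1)
    (hη' : 3 * ((k : ℝ) + 1) ≤ η * (c₀ * (1 - b₀) ^ 2 + (1 - c₀) * b₀ ^ 2) * n)
    (hsqrt : √n ≤ k) :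
    |(∑ D ∈ tableFinset (twoBlock k n R S) (twoBlock k n R S), (cornerSum D : ℝ)) /
        (tableFinset (twoBlock k n R S) (twoBlock k n R S)).card - a₀ * (k * k)| ≤
      (k * k) * (3 * (k + 1) / ((c₀ * (1 - b₀) ^ 2 + (1 - c₀) * b₀ ^ 2) * n) + √n / k +
        ((8 * n + 8) * Real.log (n + 1) + 4 / η) / (√n * k)) := by
  have hn : 0 < n := hk.trans_le hkn
  have hn0 : (0 : ℝ) < n := by exact_mod_cast hn
  have hk0 : (0 : ℝ) < k := by exact_mod_cast hk
  obtain ⟨a, b, c, ha0, ha1, hb0, hb1, hc0, hc1, e1, e2, e3⟩ := exists_block_parameters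
    (k := k) (n := n) (R := R) (S := S) hk0.le hn0 (by exact_mod_cast hkR) (by exact_mod_cast hRn)
    (by exact_mod_cast hkS) (by exact_mod_cast hSn)
  obtain ⟨Q, hQ⟩ : ∃ Q, Q = c₀ * (1 - b₀) ^ 2 + (1 - c₀) * b₀ ^ 2 := ⟨_, rfl⟩
  rw [← hQ] at hη' ⊢
  have hQ0 : 0 < Q := hQ ▸ add_pos (mul_pos hc (pow_pos (by linarith) 2))
    (mul_pos (by linarith) (pow_pos hb 2))
  have hQ1 : Q ≤ 1 := by
    have h1 : (1 - b₀) ^ 2 ≤ 1 := pow_le_one₀ (by linarith) (by linarith)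
    have h2 : b₀ ^ 2 ≤ 1 := pow_le_one₀ hb.le hb'.le
    rw [hQ]
    linarith [mul_le_mul_of_nonneg_left h1 hc.le,
      mul_le_mul_of_nonneg_left h2 (sub_nonneg.2 hc'.le)]
  have hbdiff : |b - b₀| ≤ (k + 1) / n :=
    abs_sub_le_div_of_mul_add_mul_eq hk0.le hn0 ha0.le ha1.le e1 hR
  have hcdiff : |c - c₀| ≤ (k + 1) / n :=
    abs_sub_le_div_of_mul_add_mul_eq hk0.le hn0 hb0.le hb1.le e2 hS
  have hadiff : |a - a₀| ≤ 3 * (k + 1) / (Q * n) := by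
    have h : |a - a₀| * Q ≤ 2 * |b - b₀| + |c - c₀| := hQ ▸
      abs_sub_mul_le_of_odds_eq ha0.le ha1.le hb0.le hb1.le hc0.le hc1.le hb.le hb'.le
        hc.le hc'.le e3 hodds
    have h' : 3 * ((k : ℝ) + 1) / (Q * n) = 3 * ((k + 1) / n) / Q := by
      rw [mul_div_assoc', div_div, mul_comm Q]
    rw [h', le_div_iff₀ hQ0]
    linarith
  have hsmall : 3 * ((k : ℝ) + 1) / (Q * n) ≤ η := by
    rw [div_le_iff₀ (by positivity), ← mul_assoc]
    exact hη'
  have hsmall' : ((k : ℝ) + 1) / n ≤ η := by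
    refine le_trans ?_ hsmall
    have h1 : Q * n ≤ n := mul_le_of_le_one_left hn0.le hQ1
    have h2 : ((k : ℝ) + 1) ≤ 3 * (k + 1) := by linarith
    exact div_le_div₀ (by positivity) h2 (by positivity) h1
  have hd : |(⌊a * k⌋₊ : ℝ) - a * k| ≤ 1 := abs_natFloor_sub_le (by positivity)
  have hdk : ⌊a * k⌋₊ ≤ k := Nat.floor_le_of_le (mul_le_of_le_one_left hk0.le ha1.le)
  have hsn : 0 < √(n : ℝ) := Real.sqrt_pos.2 hn0
  -- This `μ` balances `μ k²` against `n / μ`. The slack `2 * η` in the hypotheses leaves variance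
  -- `η` after moving from the limiting parameters to `a`, `b`, `c`.
  have key := abs_mean_cornerSum_sub_le (μ := √n / k) hn hkn hRn.le hkS hSn.le hdk
    (hdk.trans hkR.le) hd ha0 ha1 hb0 hb1 hc0 hc1 hη
    (sub_le_mul_one_sub ha0 ha1 ha ha' (hadiff.trans hsmall) hηa)
    (sub_le_mul_one_sub hb0 hb1 hb hb' (hbdiff.trans hsmall') hηb)
    (sub_le_mul_one_sub hc0 hc1 hc hc' (hcdiff.trans hsmall') hηc) e1 e2 e3 (by positivity)
    ((div_le_one hk0).2 hsqrt)
  generalize (∑ D ∈ tableFinset (twoBlock k n R S) (twoBlock k n R S), (cornerSum D : ℝ)) /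
        (tableFinset (twoBlock k n R S) (twoBlock k n R S)).card = m at key ⊢
  generalize (8 * (n : ℝ) + 8) * Real.log (n + 1) + 4 / η = L at key ⊢
  calc |m - a₀ * (k * k)| = |(m - a * (k * k)) + (k * k) * (a - a₀)| := by congr 1; ring
    _ ≤ (√n / k * (k * k) + L / (√n / k)) + (k * k) * (3 * (k + 1) / (Q * n)) := by
      refine (abs_add_le _ _).trans (add_le_add key ?_)
      rw [abs_mul, abs_of_nonneg (by positivity : (0 : ℝ) ≤ k * k)]
      gcongr
    _ = (k * k) * (3 * (k + 1) / (Q * n) + √n / k + L / (√n * k)) := by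
      have hL : L / (√n / k) = (k * k) * (L / (√n * k)) := by
        rw [div_div_eq_mul_div]
        field_simp
      rw [hL]
      ring

theorem log_term_le {n : ℕ} {ε η : ℝ} (hn : 1 ≤ n) (hε : 0 < ε) (hη : 0 < η) :
    (8 * n + 8) * Real.log (n + 1) + 4 / η ≤
      (16 * (2 ^ ε / ε) + 4 / η) * (n * (n : ℝ) ^ ε) := by
  have hn1 : (1 : ℝ) ≤ n := by exact_mod_cast hn
  have h1 : Real.log (n + 1) ≤ 2 ^ ε * (n : ℝ) ^ ε / ε := by
    refine (Real.log_le_rpow_div (by positivity) hε).trans ?_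
    rw [← Real.mul_rpow (by norm_num) (by positivity)]
    gcongr
    linarith
  have h2 : (1 : ℝ) ≤ n * (n : ℝ) ^ ε :=
    one_le_mul_of_one_le_of_one_le hn1 (Real.one_le_rpow hn1 hε.le)
  have h0 : 0 ≤ Real.log ((n : ℝ) + 1) := Real.log_nonneg (by linarith)
  calc (8 * n + 8) * Real.log (n + 1) + 4 / η
      ≤ (16 * n) * (2 ^ ε * (n : ℝ) ^ ε / ε) + 4 / η * (n * (n : ℝ) ^ ε) := by
        refine add_le_add (mul_le_mul (by linarith) h1 h0 (by positivity)) ?_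
        exact le_mul_of_one_le_right (by positivity) h2
    _ = _ := by ring

theorem error_terms_le {n : ℕ} {k δ ε η Q : ℝ} (hn : 1 ≤ n) (hε : 0 < ε) (hη : 0 < η) (hQ : 0 < Q)
    (hk : 1 ≤ k) (hkup : k ≤ (n : ℝ) ^ δ) (hklow : (n : ℝ) ^ δ ≤ 2 * k) :
    3 * (k + 1) / (Q * n) + √n / k + ((8 * n + 8) * Real.log (n + 1) + 4 / η) / (√n * k) ≤
      (6 / Q + 2 + 2 * (16 * (2 ^ ε / ε) + 4 / η)) *
        ((n : ℝ) ^ (δ - 1) + (n : ℝ) ^ (1 / 2 - δ + ε)) := by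
  have hn0 : (0 : ℝ) < n := by exact_mod_cast hn
  have hk0 : 0 < k := by linarith
  obtain ⟨K, hK⟩ : ∃ K, K = 16 * (2 ^ ε / ε) + 4 / η := ⟨_, rfl⟩
  have hK0 : 0 < K := by rw [hK]; positivity
  have hlog := log_term_le hn hε hη
  rw [← hK] at hlog ⊢
  obtain ⟨L, hL⟩ : ∃ L, L = (8 * n + 8) * Real.log (n + 1) + 4 / η := ⟨_, rfl⟩
  rw [← hL] at hlog ⊢
  have hs0 : 0 < √(n : ℝ) := Real.sqrt_pos.2 hn0
  have hsplit : √(n : ℝ) = (n : ℝ) ^ (1 / 2 - δ) * (n : ℝ) ^ δ := by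
    rw [Real.sqrt_eq_rpow, ← Real.rpow_add hn0]; congr 1; ring
  have hadd : (n : ℝ) ^ (1 / 2 - δ + ε) = (n : ℝ) ^ (1 / 2 - δ) * (n : ℝ) ^ ε :=
    Real.rpow_add hn0 _ _
  have hε1 : 1 ≤ (n : ℝ) ^ ε := Real.one_le_rpow (by exact_mod_cast hn) hε.le
  have hx : 0 < (n : ℝ) ^ (1 / 2 - δ) := by positivity
  have t1 : 3 * (k + 1) / (Q * n) ≤ 6 / Q * (n : ℝ) ^ (δ - 1) := by
    rw [Real.rpow_sub_one hn0.ne', div_mul_div_comm]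
    refine div_le_div_of_nonneg_right ?_ (by positivity)
    linarith
  have t2' : √(n : ℝ) / k ≤ 2 * (n : ℝ) ^ (1 / 2 - δ) := by
    rw [div_le_iff₀ hk0, hsplit]
    linarith [mul_le_mul_of_nonneg_left hklow hx.le]
  have t2 : √(n : ℝ) / k ≤ 2 * (n : ℝ) ^ (1 / 2 - δ + ε) := by
    rw [hadd]
    linarith [mul_le_mul_of_nonneg_left hε1 hx.le]
  have t3 : L / (√n * k) ≤ 2 * K * (n : ℝ) ^ (1 / 2 - δ + ε) := by
    calc L / (√n * k) ≤ K * (n * (n : ℝ) ^ ε) / (√n * k) :=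
          div_le_div_of_nonneg_right hlog (by positivity)
      _ = K * (n : ℝ) ^ ε * (√n / k) := by
          have h : √(n : ℝ) * √n = n := Real.mul_self_sqrt hn0.le
          rw [mul_div_assoc', div_eq_div_iff (by positivity) hk0.ne']
          linear_combination -(K * (n : ℝ) ^ ε * k) * h
      _ ≤ K * (n : ℝ) ^ ε * (2 * (n : ℝ) ^ (1 / 2 - δ)) :=
          mul_le_mul_of_nonneg_left t2' (by positivity)
      _ = _ := by rw [hadd]; ring
  have p1 : 0 ≤ (2 + 2 * K) * (n : ℝ) ^ (δ - 1) := by positivity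
  have p2 : 0 ≤ 6 / Q * (n : ℝ) ^ (1 / 2 - δ + ε) := by positivity
  linarith

theorem corner_tvDist_isBigO {δ B C ε : ℝ} (hB : 0 < B) (hC : 0 < C) (hε : 0 < ε)
    (hδ : 1 / 2 < δ) (hδ1 : δ < 1) (hC1 : C < 1) (hBC : B * C < 1) (q : unitInterval)
    (hq0 : 0 < (q : ℝ)) (hq1 : (q : ℝ) < 1)
    (hodds : (q : ℝ) * C * (1 - B * C) ^ 2 = (1 - q) * (1 - C) * (B * C) ^ 2) :
    (fun n : ℕ => tvDist (entryLaw n δ B C 1 1) (ber q)) =O[atTop]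
      fun n : ℕ => (n : ℝ) ^ (δ - 1) + (n : ℝ) ^ (1 / 2 - δ + ε) := by
  have hb : 0 < B * C := mul_pos hB hC
  set Q := C * (1 - B * C) ^ 2 + (1 - C) * (B * C) ^ 2 with hQ
  have hQ0 : 0 < Q := add_pos (mul_pos hC (pow_pos (by linarith) 2))
    (mul_pos (by linarith) (pow_pos hb 2))
  obtain ⟨η, hη, hηa, hηb, hηc⟩ : ∃ η : ℝ, 0 < η ∧ 2 * η ≤ (q : ℝ) * (1 - q) ∧
      2 * η ≤ (B * C) * (1 - B * C) ∧ 2 * η ≤ C * (1 - C) := by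
    refine ⟨min ((q : ℝ) * (1 - q)) (min ((B * C) * (1 - B * C)) (C * (1 - C))) / 2, ?_, ?_, ?_, ?_⟩
    · have h1 : 0 < (q : ℝ) * (1 - q) := mul_pos hq0 (by linarith)
      have h2 : 0 < (B * C) * (1 - B * C) := mul_pos hb (by linarith)
      have h3 : 0 < C * (1 - C) := mul_pos hC (by linarith)
      positivity
    · rw [mul_div_cancel₀ _ two_ne_zero]; exact min_le_left _ _
    · rw [mul_div_cancel₀ _ two_ne_zero]; exact (min_le_right _ _).trans (min_le_left _ _)
    · rw [mul_div_cancel₀ _ two_ne_zero]; exact (min_le_right _ _).trans (min_le_right _ _)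
  have hδ0 : 0 ≤ δ := by linarith
  have hhalf := (tendsto_rpow_neg_atTop (sub_pos.2 hδ)).comp tendsto_natCast_atTop_atTop
  refine IsBigO.of_bound (2 * (6 / Q + 2 + 2 * (16 * (2 ^ ε / ε) + 4 / η))) ?_
  filter_upwards [eventually_blockSize_add_two_le hδ0 hδ1 hC,
    eventually_blockSize_add_two_le hδ0 hδ1 hb,
    eventually_blockSize_add_two_le hδ0 hδ1 (show 0 < η * Q / 3 by positivity),
    hhalf.eventually_le_const (show (0 : ℝ) < 1 / 2 by norm_num),
    eventually_ge_atTop 1] with n hkC hkB hkη hh hn1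
  have hn0 : (0 : ℝ) < n := by exact_mod_cast hn1
  have hk1 := one_le_blockSize hn1 hδ0
  have hkn := blockSize_le hn1 hδ1.le
  set k := blockSize n δ with hk
  have hk1' : (1 : ℝ) ≤ k := by exact_mod_cast hk1
  have hkup : (k : ℝ) ≤ (n : ℝ) ^ δ := blockSize_le_rpow n δ
  have hklow : (n : ℝ) ^ δ ≤ 2 * k := rpow_le_two_mul_blockSize hn1 hδ0
  have hfR : |(⌊B * C * n⌋₊ : ℝ) - B * C * n| ≤ 1 := abs_natFloor_sub_le (by positivity)
  have hfS : |(⌊C * n⌋₊ : ℝ) - C * n| ≤ 1 := abs_natFloor_sub_le (by positivity)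
  have hkR : k < ⌊B * C * n⌋₊ := Nat.le_floor (by push_cast; linarith)
  have hkS : k < ⌊C * n⌋₊ := Nat.le_floor (by push_cast; linarith)
  have hRn : ⌊B * C * n⌋₊ < n := (Nat.floor_lt (by positivity)).2 (by nlinarith)
  have hSn : ⌊C * n⌋₊ < n := (Nat.floor_lt (by positivity)).2 (by nlinarith)
  have hsq : √(n : ℝ) = (n : ℝ) ^ (1 / 2 : ℝ) := Real.sqrt_eq_rpow _
  have hsplit : √(n : ℝ) = (n : ℝ) ^ (1 / 2 - δ) * (n : ℝ) ^ δ := by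
    rw [hsq, ← Real.rpow_add hn0]; congr 1; ring
  -- For large `n`, `√n ≤ n ^ δ / 2 ≤ k`, which uses `δ > 1/2`.
  have hsqrt : √(n : ℝ) ≤ k := by
    simp only [Function.comp, neg_sub] at hh
    rw [hsplit]
    have : (0 : ℝ) < (n : ℝ) ^ δ := by positivity
    nlinarith
  have hmain := abs_mean_cornerSum_div_sub_le hk1 hkn hkR hRn hkS hSn hq0 hq1 hb hBC hC hC1 hodds
    hη hηa hηb hηc hfR hfS (by linarith) hsqrt
  have hne : (blockTableFinset n δ B C).Nonempty :=
    tableFinset_twoBlock_nonempty hn1 hkn hRn.le hkS hSn.le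
  let i₀ : Fin (blockSize n δ + n) := ⟨0, by omega⟩
  have htv : tvDist (entryLaw n δ B C 1 1) (ber q) =
      2 * |(entryLaw n δ B C 1 1).real {1} - q| := tvDist_entryLaw_ber hne i₀ i₀ q
  have hmean : (k * k : ℝ) * (entryLaw n δ B C 1 1).real {1} =
      (∑ D ∈ blockTableFinset n δ B C, (cornerSum D : ℝ)) / (blockTableFinset n δ B C).card :=
    mul_entryLaw_eq_mean_cornerSum i₀ i₀ hk1 hk1
  set p := (entryLaw n δ B C 1 1).real {1} with hp
  change |(∑ D ∈ blockTableFinset n δ B C, (cornerSum D : ℝ)) / (blockTableFinset n δ B C).card -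
    q * (k * k)| ≤ _ at hmain
  rw [← hmean, mul_comm (q : ℝ), ← mul_sub, abs_mul,
    abs_of_nonneg (by positivity : (0 : ℝ) ≤ k * k)] at hmain
  have hpq := le_of_mul_le_mul_left hmain (by positivity)
  rw [htv, Real.norm_of_nonneg (by positivity), Real.norm_of_nonneg (by positivity), mul_assoc]
  refine mul_le_mul_of_nonneg_left (hpq.trans ?_) zero_le_two
  exact error_terms_le hn1 hε hη hQ0 hk1' hkup hklow

end Asymptotic

/-! ### Assembly of the three regimes. -/

theorem mainTheorem1 (δ B C ε : ℝ) (hB : 0 < B) (hC : 0 < C) (hε : 0 < ε) :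
    -- in the regimes considered here the sample space is nonempty for all large `n`
    (0 ≤ δ → δ < 1 → C < 1 → B ≤ 1 / C →
      ∀ᶠ n : ℕ in atTop, (blockTables n δ B C).Nonempty) ∧
    -- the law of an entry depends only on the block to which the entry belongs
    (∀ (n : ℕ) (i j i' j' : Fin (blockSize n δ + n)),
      ((i : ℕ) < blockSize n δ ↔ (i' : ℕ) < blockSize n δ) →
      ((j : ℕ) < blockSize n δ ↔ (j' : ℕ) < blockSize n δ) →
      entryLaw n δ B C (i + 1) (j + 1) = entryLaw n δ B C (i' + 1) (j' + 1)) ∧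
    -- bottom right block
    (0 ≤ δ → δ < 1 → C < 1 → B ≤ 1 / C →
      ∃ hq : C ∈ Set.Icc (0 : ℝ) 1,
        (fun n : ℕ => tvDist (entryLaw n δ B C (n + 1) (n + 1)) (ber ⟨C, hq⟩))
          =O[atTop] fun n : ℕ => (n : ℝ) ^ (δ - 1) + (n : ℝ) ^ (-(1 / 2) + ε)) ∧
    -- top left block
    (1 / 2 < δ → δ < 1 → C < 3 / 4 → B < 1 / (√(C / 3 - C ^ 2 / 3) + C) →
      ∃ hq : B ^ 2 * (1 - C) / (B ^ 2 - 2 * B + 1 / C) ∈ Set.Icc (0 : ℝ) 1,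
        (fun n : ℕ => tvDist (entryLaw n δ B C 1 1)
            (ber ⟨B ^ 2 * (1 - C) / (B ^ 2 - 2 * B + 1 / C), hq⟩))
          =O[atTop] fun n : ℕ => (n : ℝ) ^ (δ - 1) + (n : ℝ) ^ (1 / 2 - δ + ε)) ∧
    -- side blocks
    (0 < δ → δ < 1 → C < 3 / 4 → B < 1 / (√(C / 3 - C ^ 2 / 3) + C) →
      ∃ hq : B * C ∈ Set.Icc (0 : ℝ) 1,
        (∀ n : ℕ, tvDist (entryLaw n δ B C 1 (n + 1)) (ber ⟨B * C, hq⟩)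
          = tvDist (entryLaw n δ B C (n + 1) 1) (ber ⟨B * C, hq⟩)) ∧
        (fun n : ℕ => tvDist (entryLaw n δ B C 1 (n + 1)) (ber ⟨B * C, hq⟩))
          =O[atTop] fun n : ℕ => (n : ℝ) ^ (δ - 1) + (n : ℝ) ^ (-(δ / 2) + ε)) := by
  -- The bound on `B` enters through `B * C < 1`, which makes the limiting side density a
  -- nondegenerate probability.
  have hprod : B < 1 / (√(C / 3 - C ^ 2 / 3) + C) → B * C < 1 := fun h => by
    have h0 := Real.sqrt_nonneg (C / 3 - C ^ 2 / 3)
    rw [lt_div_iff₀ (by linarith)] at h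
    nlinarith [mul_nonneg hB.le h0]
  have hrow : ∀ n : ℕ, ∀ i : Fin (blockSize n δ + n), ¬ (i : ℕ) < blockSize n δ →
      |(blockMargin n δ B C i : ℝ) - C * n| ≤ 1 := fun n i hi => by
    rw [blockMargin, if_neg hi]
    exact abs_natFloor_sub_le (by positivity)
  have hrow' : ∀ n : ℕ, ∀ i : Fin (blockSize n δ + n), (i : ℕ) < blockSize n δ →
      |(blockMargin n δ B C i : ℝ) - B * C * n| ≤ 1 := fun n i hi => by
    rw [blockMargin, if_pos hi]
    exact abs_natFloor_sub_le (by positivity)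
  refine ⟨fun h0 h1 hC1 hBC => ?_, fun n => entryLaw_eq_of_block n δ B C, fun h0 h1 hC1 hBC => ?_,
    fun h0 h1 hC1 hBC => ?_, fun h0 h1 hC1 hBC => ?_⟩
  · filter_upwards [eventually_blockTableFinset_nonempty hC h0 h1 hC1 hBC] with n hn
    rw [← coe_blockTableFinset]
    exact hn
  · refine ⟨⟨hC.le, hC1.le⟩, tvDist_isBigO_of_second_block h0
      (eventually_blockTableFinset_nonempty hC h0 h1 hC1 hBC) _ _ (fun n => n + 1)
      (fun n => n + 1) ?_⟩
    filter_upwards [eventually_ge_atTop 1] with n hn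
    have hk := one_le_blockSize hn h0
    have hkn := blockSize_le hn h1.le
    exact ⟨⟨n, by omega⟩, ⟨n, by omega⟩, rfl, rfl, by simpa using hkn,
      hrow n _ (by simpa using hkn)⟩
  · have hC1' : C < 1 := by linarith
    have hBC' := hprod hBC
    -- The expression equals `(1 - B * C) ^ 2 + B ^ 2 * C * (1 - C)`; its second summand is the
    -- numerator of the parameter in `hq`, whence `hq1`.
    have hP : 0 < C * B ^ 2 - 2 * (B * C) + 1 := by
      have : 0 < B ^ 2 * (C * (1 - C)) := by
        have : 0 < 1 - C := by linarith
        positivity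
      nlinarith [sq_nonneg (1 - B * C)]
    have hD : B ^ 2 - 2 * B + 1 / C = (C * B ^ 2 - 2 * (B * C) + 1) / C := by
      field_simp
    have hq : B ^ 2 * (1 - C) / (B ^ 2 - 2 * B + 1 / C) =
        B ^ 2 * (1 - C) * C / (C * B ^ 2 - 2 * (B * C) + 1) := by
      rw [hD, div_div_eq_mul_div]
    have hq0 : 0 < B ^ 2 * (1 - C) / (B ^ 2 - 2 * B + 1 / C) := by
      rw [hq]
      have : 0 < 1 - C := by linarith
      positivity
    have hq1 : B ^ 2 * (1 - C) / (B ^ 2 - 2 * B + 1 / C) < 1 := by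
      rw [hq, div_lt_one hP]
      have : 0 < (1 - B * C) ^ 2 := pow_pos (by linarith) 2
      nlinarith
    have hodds : B ^ 2 * (1 - C) / (B ^ 2 - 2 * B + 1 / C) * C * (1 - B * C) ^ 2 =
        (1 - B ^ 2 * (1 - C) / (B ^ 2 - 2 * B + 1 / C)) * (1 - C) * (B * C) ^ 2 := by
      rw [hq, one_sub_div hP.ne', div_mul_eq_mul_div, div_mul_eq_mul_div, div_mul_eq_mul_div,
        div_mul_eq_mul_div]
      congr 1
      ring
    exact ⟨⟨hq0.le, hq1.le⟩, corner_tvDist_isBigO hB hC hε h0 h1 hC1' hBC' _ hq0 hq1 hodds⟩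
  · have hBC' := hprod hBC
    refine ⟨⟨(mul_pos hB hC).le, hBC'.le⟩, fun n => by rw [entryLaw_comm],
      tvDist_isBigO_of_second_block h0.le (eventually_blockTableFinset_nonempty hC h0.le h1
        (by linarith) (by rw [le_div_iff₀ hC]; exact hBC'.le)) _ _ (fun _ => 1)
      (fun n => n + 1) ?_⟩
    filter_upwards [eventually_ge_atTop 1] with n hn
    have hk := one_le_blockSize hn h0.le
    have hkn := blockSize_le hn h1.le
    exact ⟨⟨0, by omega⟩, ⟨n, by omega⟩, rfl, rfl, by simpa using hkn, hrow' n _ hk⟩
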